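/- Let $K$ be a field of characteristic $0$ and let $X$ be a set (of variables). Let $A$ be one of the following two $K$-algebras. (a) $A=K\{X\}_\infty$, the free unitary algebra on $X$ with one $k$-ary operation $\vee^k$ for each $k\ge 2$. It has as a basis the reduced planar rooted trees with leaves labelled by $X$, together with the empty tree $1$. The operation $\vee^k$ is the multilinear extension of grafting $k$ trees to a new root, where empty trees are dropped, a single remaining tree is left unchanged, and $\vee^k(1,\dots,1)=1$. (b) $A=K\{X\}$, the free unitary (non-associative) algebra on $X$ with one binary operation, whose basis is the free magma on $X$ with a unit $1$ adjoined. Let $A\otimes A$ carry the componentwise operations. Let $\Delta_a:A\to A\otimes A$ be the co-addition, i.e. the unital homomorphism for these operations with $\Delta_a(x)=x\otimes 1+1\otimes x$ for $x\in X$. Let $\varepsilon:A\to K$ be the coefficient of $1$, $\bar A=\ker\varepsilon$, $\Delta_a'(a)=\Delta_a(a)-a\otimes 1-1\otimes a$ for $a\in\bar A$, and let $W=\{a\in A:\Delta_a(a)=a\otimes 1+1\otimes a\}$ be the space of primitive elements. Then $(A,\Delta_a)$ is the cofree conilpotent cocommutative coalgebra cogenerated by $W$. That is: 1. $(A,\Delta_a,\varepsilon)$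 is a coassociative, cocommutative, counital coalgebra with $\Delta_a(1)=1\otimes 1$. The map $\Delta_a'$ takes $\bar A$ to $\bar A\otimes\bar A$ and makes $\bar A$ a coassociative cocommutative coalgebra (without counit) which is conilpotent: for every $c\in\bar A$ all sufficiently long iterated comultiplications $\bar A\to\bar A^{\otimes n}$ vanish on $c$. 2. There is an isomorphism of counital coalgebras $\Phi$ from $(A,\Delta_a,\varepsilon)$ onto the subcoalgebra $\bigoplus_{n\ge 0}(W^{\otimes n})^{\Sigma_n}$ of symmetric tensors of the standard tensor coalgebra $\bigoplus_{n\ge 0}W^{\otimes n}$ (with the deconcatenation comultiplication), such that $\Phi(1)=1$ and $\Phi(w)=w$ for all $w\in W$. Moreover, if $\pi:\bar A\to W$ denotes the degree-one component of $\Phi|_{\bar A}$, then for every conilpotent coassociative cocommutative coalgebra $D$ (without counit) and every $K$-linear map $f:D\to W$ there is exactly one coalgebra morphism $F:D\to(\bar A,\Delta_a')$ with $\pi\circ F=f$. -/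

import Mathlib

open scoped TensorProduct

universe u v w

noncomputable section

namespace PlanarPBW

/-! ### Coalgebras over the operad `Com` (no counit) and the cofree conilpotent ones -/

section Coalgebra

variable {K : Type w} [Field K] {C : Type u} [AddCommGroup C] [Module K C]

/-- Coassociativity `(δ ⊗ id) δ = (id ⊗ δ) δ`. -/
def IsCoassociative (δ : C →ₗ[K] C ⊗[K] C) : Prop :=
  (TensorProduct.assoc K C C C).toLinearMap ∘ₗ δ.rTensor C ∘ₗ δ = δ.lTensor C ∘ₗ δ

/-- Cocommutativity `τ δ = δ`. -/
def IsCocommutative (δ : C →ₗ[K] C ⊗[K] C) : Prop :=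
  (TensorProduct.comm K C C).toLinearMap ∘ₗ δ = δ

/-- The iterated comultiplication `δⁿ : C → C^{⊗(n+1)}`, where `δ⁰ = id` and
`δⁿ⁺¹ = (δⁿ ⊗ id) δ`; the space `C^{⊗(n+1)}` is taken as the component of degree `n + 1`
of the tensor algebra of `C`. -/
def iterComul (δ : C →ₗ[K] C ⊗[K] C) : ℕ → C →ₗ[K] TensorAlgebra K C
  | 0 => TensorAlgebra.ι K
  | n + 1 => LinearMap.mul' K (TensorAlgebra K C) ∘ₗ
      TensorProduct.map (iterComul δ n) (TensorAlgebra.ι K) ∘ₗ δ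

/-- A (co-)nilpotent `Com`-coalgebra: coassociative, cocommutative, and every element is killed
by all sufficiently long iterated comultiplications. -/
structure IsConilpotentComCoalgebra (δ : C →ₗ[K] C ⊗[K] C) : Prop where
  coassoc : IsCoassociative δ
  cocomm : IsCocommutative δ
  conilpotent : ∀ c : C, ∃ N : ℕ, ∀ n : ℕ, N < n → iterComul δ n c = 0

/-- The universal property of the cofree conilpotent `Com`-coalgebra `(C, δ)` cogenerated by `V`
with respect to the projection `π : C → V`: every linear map `f` from a conilpotent
`Com`-coalgebra `D` to `V` lifts uniquely to a morphism of coalgebras `D → C`. -/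
def HasCofreeProperty {V : Type u} [AddCommGroup V] [Module K V]
    (δ : C →ₗ[K] C ⊗[K] C) (π : C →ₗ[K] V) : Prop :=
  ∀ (D : Type v) [AddCommGroup D] [Module K D] (δD : D →ₗ[K] D ⊗[K] D),
    IsConilpotentComCoalgebra δD → ∀ f : D →ₗ[K] V,
      ∃! F : D →ₗ[K] C, δ ∘ₗ F = TensorProduct.map F F ∘ₗ δD ∧ π ∘ₗ F = f

end Coalgebra

/-! ### The standard tensor coalgebra and its subcoalgebra of symmetric tensors -/

section Tensor

variable (K : Type w) [Field K] (V : Type u) [AddCommGroup V] [Module K V]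

/-- Left multiplication by `v` on pairs `(t, Δ t)`:
`(t, z) ↦ (v t, 1 ⊗ v t + (v ⊗ 1) z)`. -/
def deconcatStep : V →ₗ[K]
    Module.End K (TensorAlgebra K V × (TensorAlgebra K V ⊗[K] TensorAlgebra K V)) :=
  LinearMap.mk₂ K
    (fun v p => (TensorAlgebra.ι K v * p.1,
      (1 : TensorAlgebra K V) ⊗ₜ[K] (TensorAlgebra.ι K v * p.1) +
        (TensorAlgebra.ι K v ⊗ₜ[K] (1 : TensorAlgebra K V)) * p.2))
    (fun a b p => by
      ext <;> simp [add_mul, TensorProduct.tmul_add, TensorProduct.add_tmul]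
      abel)
    (fun c a p => by
      ext <;> simp [← TensorProduct.smul_tmul'])
    (fun a p q => by
      ext <;> simp [mul_add, TensorProduct.tmul_add]
      abel)
    (fun c a p => by
      ext <;> simp)

/-- The deconcatenation comultiplication of the standard tensor coalgebra,
`Δ (v₁ ⋯ vₙ) = ∑ⱼ (v₁ ⋯ vⱼ) ⊗ (vⱼ₊₁ ⋯ vₙ)`, `0 ≤ j ≤ n`; see `deconcat_prod`. -/
def deconcat : TensorAlgebra K V →ₗ[K] TensorAlgebra K V ⊗[K] TensorAlgebra K V :=
  LinearMap.snd K _ _ ∘ₗ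
    LinearMap.applyₗ ((1 : TensorAlgebra K V),
      (1 : TensorAlgebra K V) ⊗ₜ[K] (1 : TensorAlgebra K V)) ∘ₗ
    (TensorAlgebra.lift K (deconcatStep K V)).toLinearMap

variable {V} in
theorem deconcat_prod (l : List V) :
    deconcat K V ((l.map (TensorAlgebra.ι K)).prod) =
      ∑ j ∈ Finset.range (l.length + 1),
        ((l.take j).map (TensorAlgebra.ι K)).prod ⊗ₜ[K]
          ((l.drop j).map (TensorAlgebra.ι K)).prod := by
  have key : ∀ l : List V,
      (TensorAlgebra.lift K (deconcatStep K V)) ((l.map (TensorAlgebra.ι K)).prod)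
        ((1 : TensorAlgebra K V), (1 : TensorAlgebra K V) ⊗ₜ[K] (1 : TensorAlgebra K V)) =
      ((l.map (TensorAlgebra.ι K)).prod,
        ∑ j ∈ Finset.range (l.length + 1),
          ((l.take j).map (TensorAlgebra.ι K)).prod ⊗ₜ[K]
            ((l.drop j).map (TensorAlgebra.ι K)).prod) := by
    intro l
    induction l with
    | nil => simp
    | cons a l ih =>
      rw [List.map_cons, List.prod_cons, map_mul, Module.End.mul_apply, ih,
        TensorAlgebra.lift_ι_apply]
      simp only [deconcatStep, LinearMap.mk₂_apply, List.length_cons]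
      rw [Finset.sum_range_succ' _ (l.length + 1), Finset.mul_sum]
      simp [add_comm]
  simp [deconcat, key l]

/-- The projection of the tensor algebra onto its component of degree one. -/
def degreeOne : TensorAlgebra K V →ₗ[K] V :=
  letI : Module Kᵐᵒᵖ V := Module.compHom _ ((RingHom.id K).fromOpposite mul_comm)
  haveI : IsCentralScalar K V := ⟨fun _ _ => rfl⟩
  TrivSqZeroExt.sndHom K V ∘ₗ (TensorAlgebra.toTrivSqZeroExt (R := K) (M := V)).toLinearMap

/-- The space `⨁ₙ (V^{⊗n})^{Σₙ}` of symmetric tensors, as a subspace of the tensor algebra. -/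
def symmetricTensors : Submodule K (TensorAlgebra K V) :=
  ⨆ n : ℕ, Submodule.map (TensorPower.toTensorAlgebra (R := K) (M := V) (n := n))
    (⨅ σ : Equiv.Perm (Fin n),
      LinearMap.eqLocus (PiTensorProduct.reindex K (fun _ : Fin n => V) σ).toLinearMap
        LinearMap.id)

end Tensor

/-! ### Augmented coalgebras, primitive elements -/

section Augmented

variable {K : Type w} [Field K] {A : Type u} [AddCommGroup A] [Module K A]

/-- The space of primitive elements, `Δ a = a ⊗ 1 + 1 ⊗ a`. -/
def prim (e : A) (Δ : A →ₗ[K] A ⊗[K] A) : Submodule K A :=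
  LinearMap.eqLocus Δ ((TensorProduct.mk K A A).flip e + TensorProduct.mk K A A e)

/-- The projection `a ↦ a - ε(a) 1` of `A` onto the augmentation ideal `ker ε`. -/
def augProj (e : A) (ε : A →ₗ[K] K) (he : ε e = 1) : A →ₗ[K] LinearMap.ker ε :=
  LinearMap.codRestrict (LinearMap.ker ε) (LinearMap.id - ε.smulRight e)
    (fun a => by simp [he])

/-- The reduced comultiplication `Δ' a = Δ a - a ⊗ 1 - 1 ⊗ a` on the augmentation ideal, with
values in the tensor square of the augmentation ideal. It is obtained by applying the projection
`id - ε(·) 1` to both tensor factors of `Δ a`, see `map_reducedComul`. -/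
def reducedComul (e : A) (ε : A →ₗ[K] K) (he : ε e = 1) (Δ : A →ₗ[K] A ⊗[K] A) :
    LinearMap.ker ε →ₗ[K] LinearMap.ker ε ⊗[K] LinearMap.ker ε :=
  TensorProduct.map (augProj e ε he) (augProj e ε he) ∘ₗ Δ ∘ₗ (LinearMap.ker ε).subtype

theorem map_reducedComul (e : A) (ε : A →ₗ[K] K) (he : ε e = 1) (Δ : A →ₗ[K] A ⊗[K] A)
    (hl : (TensorProduct.lid K A).toLinearMap ∘ₗ ε.rTensor A ∘ₗ Δ = LinearMap.id)
    (hr : (TensorProduct.rid K A).toLinearMap ∘ₗ ε.lTensor A ∘ₗ Δ = LinearMap.id)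
    (a : LinearMap.ker ε) :
    TensorProduct.map (LinearMap.ker ε).subtype (LinearMap.ker ε).subtype
        (reducedComul e ε he Δ a) = Δ a - (a : A) ⊗ₜ[K] e - e ⊗ₜ[K] (a : A) := by
  have key : ∀ z : A ⊗[K] A,
      TensorProduct.map (LinearMap.ker ε).subtype (LinearMap.ker ε).subtype
        (TensorProduct.map (augProj e ε he) (augProj e ε he) z) =
      z - (TensorProduct.rid K A (ε.lTensor A z)) ⊗ₜ[K] e
        - e ⊗ₜ[K] (TensorProduct.lid K A (ε.rTensor A z))
        + ε (TensorProduct.lid K A (ε.rTensor A z)) • (e ⊗ₜ[K] e) := by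
    intro z
    induction z with
    | zero => simp
    | add x y hx hy =>
      simp only [map_add, hx, hy, TensorProduct.add_tmul, TensorProduct.tmul_add, add_smul]
      abel
    | tmul x y =>
      have hp : ∀ x : A, ((augProj e ε he x : LinearMap.ker ε) : A) = x - ε x • e :=
        fun _ => rfl
      simp only [TensorProduct.map_tmul, Submodule.subtype_apply, hp, TensorProduct.sub_tmul,
        TensorProduct.tmul_sub, LinearMap.lTensor_tmul, LinearMap.rTensor_tmul,
        TensorProduct.lid_tmul, TensorProduct.rid_tmul, TensorProduct.tmul_smul,
        TensorProduct.smul_tmul', map_smul, smul_eq_mul, mul_smul]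
      rw [smul_sub, TensorProduct.smul_tmul', TensorProduct.smul_tmul', smul_comm (ε y) (ε x)]
      abel
  have h1 := LinearMap.congr_fun hl (a : A)
  have h2 := LinearMap.congr_fun hr (a : A)
  simp only [LinearMap.comp_apply, LinearEquiv.coe_coe, LinearMap.id_apply] at h1 h2
  have h3 : ε (a : A) = 0 := a.2
  simp only [reducedComul, LinearMap.comp_apply, Submodule.subtype_apply, key, h1, h2, h3]
  simp

/-- `(A, Δ)`, with unit `e` and counit `ε`, is a cofree conilpotent `Com`-coalgebra cogenerated
by its space `W` of primitive elements.

It is a counital coassociative cocommutative coalgebra with group-like element `e`; its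
augmentation ideal is a conilpotent `Com`-coalgebra under the reduced comultiplication; and there
is an isomorphism `Φ` of counital coalgebras from `A` onto the subcoalgebra of symmetric tensors of
the standard tensor coalgebra on `W`, with `Φ e = 1` and `Φ w = w` for all `w` in `W`, such that
the augmentation ideal, together with the projection to `W` given by the degree one component of
`Φ`, has the universal property of the cofree conilpotent `Com`-coalgebra cogenerated by `W`. -/
structure IsCofreeOnPrimitives (e : A) (ε : A →ₗ[K] K) (he : ε e = 1)
    (Δ : A →ₗ[K] A ⊗[K] A) : Prop where
  coassoc : IsCoassociative Δ
  cocomm : IsCocommutative Δ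
  counit_left : (TensorProduct.lid K A).toLinearMap ∘ₗ ε.rTensor A ∘ₗ Δ = LinearMap.id
  counit_right : (TensorProduct.rid K A).toLinearMap ∘ₗ ε.lTensor A ∘ₗ Δ = LinearMap.id
  comul_one : Δ e = e ⊗ₜ[K] e
  conilpotent : IsConilpotentComCoalgebra (reducedComul e ε he Δ)
  cofree : ∃ Φ : A →ₗ[K] TensorAlgebra K (prim e Δ),
    Function.Injective Φ ∧
    LinearMap.range Φ = symmetricTensors K (prim e Δ) ∧
    deconcat K (prim e Δ) ∘ₗ Φ = TensorProduct.map Φ Φ ∘ₗ Δ ∧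
    (TensorAlgebra.algebraMapInv (R := K) (M := prim e Δ)).toLinearMap ∘ₗ Φ = ε ∧
    Φ e = 1 ∧
    (∀ x : prim e Δ, Φ (x : A) = TensorAlgebra.ι K x) ∧
    HasCofreeProperty.{u, v, w} (reducedComul e ε he Δ)
      (degreeOne K (prim e Δ) ∘ₗ Φ ∘ₗ (LinearMap.ker ε).subtype)

end Augmented

/-! ### `K{X}_∞`: the free unitary algebra with one operation `∨ᵏ` in each arity `k ≥ 2` -/

/-- Non-empty reduced planar rooted trees with leaves labelled by `X`; every inner vertex has
`n + 2 ≥ 2` ordered incoming edges. -/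
inductive PRTree (X : Type u) : Type u
  | leaf : X → PRTree X
  | node : (n : ℕ) → (Fin (n + 2) → PRTree X) → PRTree X

section MagOmega

variable {X : Type u}

/-- Grafting of a planar forest whose members may be the empty tree `none`: the empty trees are
dropped; no remaining tree gives the empty tree, a single one is left unchanged, and `n + 2`
remaining trees are joined by a new root. -/
def graft (l : List (Option (PRTree X))) : Option (PRTree X) :=
  match l.reduceOption with
  | [] => none
  | [t] => some t
  | t :: s :: r => some (PRTree.node r.length (fun i => (t :: s :: r).get i))

variable (K : Type w) [Field K] (X)

/-- The vector space `K{X}_∞` with basis the monomials: the labelled reduced planar trees and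
the empty tree `none`, which is the unit. -/
abbrev MagOmegaAlg : Type (max u w) := Option (PRTree X) →₀ K

/-- The basis of monomials. -/
abbrev monomialBasis : Module.Basis (Option (PRTree X)) K (MagOmegaAlg X K) :=
  Finsupp.basisSingleOne

/-- The `k`-ary operation `∨ᵏ` of `K{X}_∞`, the multilinear extension of grafting. -/
def vee (k : ℕ) : MultilinearMap K (fun _ : Fin k => MagOmegaAlg X K) (MagOmegaAlg X K) :=
  ((Basis.piTensorProduct (fun _ : Fin k => monomialBasis X K)).constr K
    (fun T => Finsupp.single (graft (List.ofFn T)) 1)).compMultilinearMap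
      (PiTensorProduct.tprod K)

/-- The `k`-ary operation `∨ᵏ` of `K{X}_∞ ⊗ K{X}_∞`, which is componentwise:
`∨ᵏ(a₁ ⊗ b₁, …, aₖ ⊗ bₖ) = ∨ᵏ(a₁, …, aₖ) ⊗ ∨ᵏ(b₁, …, bₖ)`; see `veeTensor_tmul`. -/
def veeTensor (k : ℕ) :
    MultilinearMap K (fun _ : Fin k => MagOmegaAlg X K ⊗[K] MagOmegaAlg X K)
      (MagOmegaAlg X K ⊗[K] MagOmegaAlg X K) :=
  ((Basis.piTensorProduct
      (fun _ : Fin k => (monomialBasis X K).tensorProduct (monomialBasis X K))).constr K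
    (fun T => vee X K k (fun i => monomialBasis X K (T i).1) ⊗ₜ[K]
      vee X K k (fun i => monomialBasis X K (T i).2))).compMultilinearMap
      (PiTensorProduct.tprod K)

variable {X}

/-- The co-addition on trees: `x ↦ x ⊗ 1 + 1 ⊗ x` for `x ∈ X`, compatible with all `∨ᵏ`. -/
def coaddTree : PRTree X → MagOmegaAlg X K ⊗[K] MagOmegaAlg X K
  | PRTree.leaf x =>
      Finsupp.single (some (PRTree.leaf x)) 1 ⊗ₜ[K] Finsupp.single none 1 +
        Finsupp.single none 1 ⊗ₜ[K] Finsupp.single (some (PRTree.leaf x)) 1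
  | PRTree.node n T => veeTensor X K (n + 2) (fun i => coaddTree (T i))

variable (X)

/-- The co-addition `Δ_a : K{X}_∞ → K{X}_∞ ⊗ K{X}_∞`, the homomorphism for all operations
`∨ᵏ` with `1 ↦ 1 ⊗ 1` and `x ↦ x ⊗ 1 + 1 ⊗ x` for `x ∈ X`. -/
def coaddInf : MagOmegaAlg X K →ₗ[K] MagOmegaAlg X K ⊗[K] MagOmegaAlg X K :=
  (monomialBasis X K).constr K fun T =>
    match T with
    | none => Finsupp.single none 1 ⊗ₜ[K] Finsupp.single none 1
    | some t => coaddTree K t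

/-- The augmentation of `K{X}_∞`: the coefficient of the empty tree. -/
def counitInf : MagOmegaAlg X K →ₗ[K] K := Finsupp.lapply none

theorem counitInf_one : counitInf X K (Finsupp.single none 1) = 1 := by
  simp [counitInf]

variable {X K}

theorem vee_monomial {k : ℕ} (T : Fin k → Option (PRTree X)) :
    vee X K k (fun i => Finsupp.single (T i) 1) = Finsupp.single (graft (List.ofFn T)) 1 := by
  have h := (Basis.piTensorProduct (fun _ : Fin k => monomialBasis X K)).constr_basis K
    (fun T => Finsupp.single (graft (List.ofFn T)) (1 : K)) T
  simpa [vee] using h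

theorem veeTensor_tmul {k : ℕ} (a b : Fin k → MagOmegaAlg X K) :
    veeTensor X K k (fun i => a i ⊗ₜ[K] b i) = vee X K k a ⊗ₜ[K] vee X K k b := by
  have h1 : ∀ S T : Fin k → Option (PRTree X),
      veeTensor X K k (fun i => monomialBasis X K (S i) ⊗ₜ[K] monomialBasis X K (T i)) =
        vee X K k (fun i => monomialBasis X K (S i)) ⊗ₜ[K]
          vee X K k (fun i => monomialBasis X K (T i)) := by
    intro S T
    have h := (Basis.piTensorProduct
      (fun _ : Fin k => (monomialBasis X K).tensorProduct (monomialBasis X K))).constr_basis K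
      (fun T => vee X K k (fun i => monomialBasis X K (T i).1) ⊗ₜ[K]
        vee X K k (fun i => monomialBasis X K (T i).2)) (fun i => (S i, T i))
    rw [Basis.piTensorProduct_apply] at h
    simp only [Module.Basis.tensorProduct_apply] at h
    exact h
  have h2 : ∀ S : Fin k → Option (PRTree X), ∀ b : Fin k → MagOmegaAlg X K,
      veeTensor X K k (fun i => monomialBasis X K (S i) ⊗ₜ[K] b i) =
        vee X K k (fun i => monomialBasis X K (S i)) ⊗ₜ[K] vee X K k b := by
    intro S b
    have h : (veeTensor X K k).compLinearMap
          (fun i => TensorProduct.mk K _ _ (monomialBasis X K (S i))) =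
        (TensorProduct.mk K _ _
          (vee X K k (fun i => monomialBasis X K (S i)))).compMultilinearMap (vee X K k) :=
      Module.Basis.ext_multilinear (fun _ => monomialBasis X K) (fun T => h1 S T)
    exact congrArg (fun g => g b) h
  have h : (veeTensor X K k).compLinearMap (fun i => (TensorProduct.mk K _ _).flip (b i)) =
      ((TensorProduct.mk K _ _).flip (vee X K k b)).compMultilinearMap (vee X K k) :=
    Module.Basis.ext_multilinear (fun _ => monomialBasis X K) (fun S => h2 S b)
  exact congrArg (fun g => g a) h

end MagOmega

/-! ### `K{X}`: the free unitary algebra with one binary operation -/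

section Mag

variable (X : Type u) (K : Type w) [Field K]

/-- The free unitary magma algebra `K{X}`: the (non-associative, unital) algebra with basis the
free magma on `X` with a unit adjoined. -/
abbrev MagAlg : Type (max u w) := MonoidAlgebra K (WithOne (FreeMagma X))

/-- The monomial `x ∈ X`. -/
def MagAlg.of (x : X) : MagAlg X K :=
  MonoidAlgebra.single (WithOne.coe (FreeMagma.of x)) 1

/-- The co-addition `Δ_a : K{X} → K{X} ⊗ K{X}`, the homomorphism of unital algebras with
`x ↦ x ⊗ 1 + 1 ⊗ x` for `x ∈ X`. -/
def coaddHom : MagAlg X K →ₙₐ[K] MagAlg X K ⊗[K] MagAlg X K :=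
  MonoidAlgebra.liftMagma K
    (WithOne.lift (FreeMagma.lift fun x =>
      MagAlg.of X K x ⊗ₜ[K] (1 : MagAlg X K) + (1 : MagAlg X K) ⊗ₜ[K] MagAlg.of X K x)).toMulHom

/-- The co-addition of `K{X}` as a linear map. -/
def coaddMag : MagAlg X K →ₗ[K] MagAlg X K ⊗[K] MagAlg X K := (coaddHom X K : _ →ₗ[K] _)

/-- The augmentation of `K{X}`: the coefficient of `1`. -/
def counitMag : MagAlg X K →ₗ[K] K :=
  Finsupp.lapply 1 ∘ₗ (MonoidAlgebra.coeffLinearEquiv K).toLinearMap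

theorem counitMag_one : counitMag X K 1 = 1 := by
  simp [counitMag, MonoidAlgebra.one_def]

end Mag

end PlanarPBW

end

/-! Both algebras are generated by primitive elements under operations that are coalgebra morphisms
fixing the unit. Coassociativity, cocommutativity and the counit laws therefore spread from
generators to all monomials. Conilpotency follows because the co-addition splits degrees additively
and only the unit is a monomial of degree zero (`IsPrimitivelyGenerated`).

Choose any linear projection `π` from the augmentation ideal onto the primitives `W`. Conilpotency
makes the sum of the maps `π^{⊗(n+1)} δⁿ` finite on each element, so it defines a map to the tensor
algebra; together with the counit it gives a coalgebra map `Φ = toTensor π` (`deconcat_lift`). Its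
values are symmetric tensors by cocommutativity (`lift_perm`), and it is injective because it is
injective on primitives (`lift_injective`).

Surjectivity onto symmetric tensors is where a product and characteristic zero enter. It needs only
one binary operation with two-sided unit that is a coalgebra morphism; associativity plays no role.
Up to terms of lower degree, multiplication by a primitive `x` becomes the shuffle with the letter
`x` (`coef_prim_mul`). If a symmetric `t` of degree at most `n + 1` has top part `∑ bⱼ dⱼ` with `bⱼ`
basis letters, each `dⱼ` is `Φ(cⱼ)` by induction, and `Φ(∑ bⱼ cⱼ)` agrees with `(n + 1) t` in degree
`n + 1`. Induction handles the difference, and `n + 1` is invertible (`mem_range_toTensor`).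

For the universal property, a map `f : D → W` lifts to the tensor coalgebra with symmetric values.
These lie in the image of `Φ`, so the lift can be pulled back along `Φ` (`hasCofreeProperty`). -/

noncomputable section

namespace PlanarPBW

/-! ### Word coordinates on the tensor coalgebra and its symmetric tensors. -/

section TensorCoordinates

variable {K : Type w} [Field K] {V : Type u} [AddCommGroup V] [Module K V]
  {I : Type*} (b : Module.Basis I K V)

/-- The basis of words of the tensor algebra. -/
def wordBasis : Module.Basis (List I) K (TensorAlgebra K V) :=
  b.tensorAlgebra.reindex FreeMonoid.toList

theorem wordBasis_apply (l : List I) :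
    wordBasis b l = (l.map fun i => TensorAlgebra.ι K (b i)).prod := by
  have h : wordBasis b l = (TensorAlgebra.equivFreeAlgebra b).symm
      (FreeAlgebra.equivMonoidAlgebraFreeMonoid.symm
        (MonoidAlgebra.single (FreeMonoid.ofList l) 1)) := by
    simp [wordBasis, Module.Basis.tensorAlgebra, FreeAlgebra.basisFreeMonoid]
  rw [h]
  clear h
  induction l with
  | nil =>
    have : (MonoidAlgebra.single (FreeMonoid.ofList ([] : List I)) (1 : K)) = 1 := rfl
    rw [this, map_one, map_one, List.map_nil, List.prod_nil]
  | cons i l ih =>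
    have : (MonoidAlgebra.single (FreeMonoid.ofList (i :: l)) (1 : K)) =
        MonoidAlgebra.single (FreeMonoid.of i) 1 * MonoidAlgebra.single (FreeMonoid.ofList l) 1 := by
      simp [MonoidAlgebra.single_mul_single]
    rw [this, map_mul, map_mul, ih]
    have h2 : FreeAlgebra.equivMonoidAlgebraFreeMonoid.symm
        (MonoidAlgebra.single (FreeMonoid.of i) (1 : K)) = FreeAlgebra.ι K i := by
      rw [AlgEquiv.symm_apply_eq]
      simp [FreeAlgebra.equivMonoidAlgebraFreeMonoid]
    simp [h2]

theorem wordBasis_nil : wordBasis b [] = 1 := by simp [wordBasis_apply]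

theorem wordBasis_cons (i : I) (l : List I) :
    wordBasis b (i :: l) = TensorAlgebra.ι K (b i) * wordBasis b l := by
  simp [wordBasis_apply]

theorem wordBasis_append (l m : List I) :
    wordBasis b (l ++ m) = wordBasis b l * wordBasis b m := by
  simp [wordBasis_apply]

/-- The coefficient of a word in an element of the tensor algebra. -/
def coef (l : List I) : TensorAlgebra K V →ₗ[K] K := (wordBasis b).coord l

open Classical in
theorem coef_wordBasis (l m : List I) : coef b l (wordBasis b m) = if m = l then 1 else 0 := by
  simp [coef, Finsupp.single_apply]

variable {b} in
theorem ext_coef {t s : TensorAlgebra K V} (h : ∀ l, coef b l t = coef b l s) : t = s :=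
  (wordBasis b).ext_elem h

theorem coef_nil_ι_mul (v : V) (t : TensorAlgebra K V) :
    coef b [] (TensorAlgebra.ι K v * t) = 0 := by
  have : coef b [] ∘ₗ LinearMap.mul' K _ ∘ₗ
      TensorProduct.map (TensorAlgebra.ι K) LinearMap.id = 0 := by
    refine (b.tensorProduct (wordBasis b)).ext fun ⟨i, m⟩ => ?_
    simp [← wordBasis_cons, coef_wordBasis]
  simpa using LinearMap.congr_fun this (v ⊗ₜ t)

theorem coef_cons_ι_mul (i : I) (l : List I) (v : V) (t : TensorAlgebra K V) :
    coef b (i :: l) (TensorAlgebra.ι K v * t) = b.coord i v * coef b l t := by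
  classical
  have : coef b (i :: l) ∘ₗ LinearMap.mul' K _ ∘ₗ
      TensorProduct.map (TensorAlgebra.ι K) LinearMap.id =
      LinearMap.mul' K K ∘ₗ TensorProduct.map (b.coord i) (coef b l) := by
    refine (b.tensorProduct (wordBasis b)).ext fun ⟨j, m⟩ => ?_
    simp only [Module.Basis.tensorProduct_apply, LinearMap.comp_apply, TensorProduct.map_tmul,
      LinearMap.mul'_apply, LinearMap.id_apply, ← wordBasis_cons, coef_wordBasis,
      Module.Basis.coord_apply, Module.Basis.repr_self, Finsupp.single_apply, List.cons.injEq]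
    split_ifs <;> simp_all
  simpa using LinearMap.congr_fun this (v ⊗ₜ t)

theorem coef_nil_one : coef b [] 1 = 1 := by
  classical rw [← wordBasis_nil b, coef_wordBasis, if_pos rfl]

theorem coef_cons_one (i : I) (l : List I) : coef b (i :: l) 1 = 0 := by
  classical rw [← wordBasis_nil b, coef_wordBasis, if_neg (by simp)]

theorem coef_singleton_ι (i : I) (v : V) : coef b [i] (TensorAlgebra.ι K v) = b.coord i v := by
  simpa [coef_nil_one] using coef_cons_ι_mul b i [] v 1

theorem coef_nil : coef b [] = (TensorAlgebra.algebraMapInv (R := K) (M := V)).toLinearMap := by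
  refine (wordBasis b).ext fun l => ?_
  cases l with
  | nil => simp [wordBasis_nil, coef_nil_one]
  | cons i l => simp [wordBasis_cons, coef_nil_ι_mul, TensorAlgebra.algebraMapInv]

theorem degreeOne_ι (v : V) : degreeOne K V (TensorAlgebra.ι K v) = v := by
  simp [degreeOne]

theorem degreeOne_ι_mul (v : V) (t : TensorAlgebra K V) :
    degreeOne K V (TensorAlgebra.ι K v * t) = TensorAlgebra.algebraMapInv t • v := by
  let _ : Module Kᵐᵒᵖ V := Module.compHom _ ((RingHom.id K).fromOpposite mul_comm)
  have : IsCentralScalar K V := ⟨fun _ _ => rfl⟩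
  have h : TensorAlgebra.algebraMapInv t =
      (TensorAlgebra.toTrivSqZeroExt (R := K) (M := V) t).fst := by
    have : (TensorAlgebra.algebraMapInv : TensorAlgebra K V →ₐ[K] K) =
        (TrivSqZeroExt.fstHom K K V).comp TensorAlgebra.toTrivSqZeroExt := by
      ext; simp [TensorAlgebra.algebraMapInv]
    exact DFunLike.congr_fun this t
  rw [h]
  simp [degreeOne]

theorem deconcat_one : deconcat K V 1 = 1 ⊗ₜ 1 := by
  simpa using deconcat_prod K ([] : List V)

/-- The recursion hidden in `deconcatStep`: once the first entry of the pair is known to be `t`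
itself, reading off the second entry after one more letter gives the formula. -/
theorem deconcat_ι_mul (v : V) (t : TensorAlgebra K V) :
    deconcat K V (TensorAlgebra.ι K v * t) =
      1 ⊗ₜ (TensorAlgebra.ι K v * t) + (TensorAlgebra.ι K v ⊗ₜ 1) * deconcat K V t := by
  have key : ∀ t, TensorAlgebra.lift K (deconcatStep K V) t (1, 1 ⊗ₜ 1) =
      (t, deconcat K V t) := by
    intro t
    refine Prod.ext ?_ rfl
    have : LinearMap.fst K _ _ ∘ₗ LinearMap.applyₗ ((1 : TensorAlgebra K V),
        (1 : TensorAlgebra K V) ⊗ₜ[K] (1 : TensorAlgebra K V)) ∘ₗ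
        (TensorAlgebra.lift K (deconcatStep K V)).toLinearMap = LinearMap.id := by
      refine (wordBasis (Module.Basis.ofVectorSpace K V)).ext fun l => ?_
      induction l with
      | nil => simp [wordBasis_nil]
      | cons i l ih =>
        simp only [LinearMap.comp_apply, AlgHom.toLinearMap_apply, LinearMap.applyₗ_apply_apply,
          LinearMap.fst_apply, LinearMap.id_apply] at ih
        rw [wordBasis_cons]
        simp only [LinearMap.comp_apply, AlgHom.toLinearMap_apply, LinearMap.applyₗ_apply_apply,
          map_mul, Module.End.mul_apply, TensorAlgebra.lift_ι_apply, deconcatStep,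
          LinearMap.mk₂_apply, LinearMap.fst_apply, LinearMap.id_apply]
        rw [← deconcatStep, ih]
    exact LinearMap.congr_fun this t
  have h := congrArg Prod.snd (key (TensorAlgebra.ι K v * t))
  rw [map_mul, Module.End.mul_apply, key, TensorAlgebra.lift_ι_apply] at h
  simpa [deconcatStep] using h.symm

theorem deconcat_ι (v : V) :
    deconcat K V (TensorAlgebra.ι K v) =
      1 ⊗ₜ TensorAlgebra.ι K v + TensorAlgebra.ι K v ⊗ₜ 1 := by
  simpa [deconcat_one] using deconcat_ι_mul (K := K) v 1

/-- The pairing of a pair of functionals with a tensor. -/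
abbrev pairing {C D : Type*} [AddCommGroup C] [Module K C] [AddCommGroup D] [Module K D]
    (φ : C →ₗ[K] K) (ψ : D →ₗ[K] K) : C ⊗[K] D →ₗ[K] K :=
  LinearMap.mul' K K ∘ₗ TensorProduct.map φ ψ

/-- Deconcatenation is dual to concatenation of words. This turns later identities about coalgebra
maps into identities between scalar coefficients. -/
theorem coef_append (m l : List I) (t : TensorAlgebra K V) :
    coef b (m ++ l) t = pairing (coef b m) (coef b l) (deconcat K V t) := by
  have hl : ∀ (v : V) (j : I) (m : List I) (z : TensorAlgebra K V ⊗[K] TensorAlgebra K V),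
      pairing (coef b (j :: m)) (coef b l) ((TensorAlgebra.ι K v ⊗ₜ 1) * z) =
        b.coord j v * pairing (coef b m) (coef b l) z := by
    intro v j m z
    induction z with
    | zero => simp
    | add x y hx hy => rw [mul_add, map_add, hx, hy, map_add, mul_add]
    | tmul x y => simp [coef_cons_ι_mul]; ring
  have hn : ∀ (v : V) (z : TensorAlgebra K V ⊗[K] TensorAlgebra K V),
      pairing (coef b []) (coef b l) ((TensorAlgebra.ι K v ⊗ₜ 1) * z) = 0 := by
    intro v z
    induction z with
    | zero => simp
    | add x y hx hy => rw [mul_add, map_add, hx, hy, add_zero]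
    | tmul x y => simp [coef_nil_ι_mul]
  suffices h : coef b (m ++ l) = pairing (coef b m) (coef b l) ∘ₗ deconcat K V from
    LinearMap.congr_fun h t
  induction m with
  | nil =>
    refine (wordBasis b).ext fun k => ?_
    cases k with
    | nil => simp [wordBasis_nil, deconcat_one, coef_nil_one]
    | cons i k =>
      rw [wordBasis_cons, LinearMap.comp_apply, deconcat_ι_mul, map_add, hn]
      simp [coef_nil_one]
  | cons j m ih =>
    refine (wordBasis b).ext fun k => ?_
    cases k with
    | nil => simp [wordBasis_nil, deconcat_one, coef_cons_one]
    | cons i k =>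
      rw [wordBasis_cons, LinearMap.comp_apply, deconcat_ι_mul, map_add, hl, List.cons_append,
        coef_cons_ι_mul, ih]
      simp [coef_cons_one]

/-! ### Symmetric tensors in coordinates -/

theorem toTensorAlgebra_piTensorProduct {n : ℕ} (m : Fin n → I) :
    TensorPower.toTensorAlgebra (Basis.piTensorProduct (fun _ : Fin n => b) m) =
      wordBasis b (List.ofFn m) := by
  rw [Basis.piTensorProduct_apply, TensorPower.toTensorAlgebra_tprod, TensorAlgebra.tprod_apply,
    wordBasis_apply, List.map_ofFn]
  rfl

theorem coef_toTensorAlgebra_ofFn {n : ℕ} (m : Fin n → I) (u : ⨂[K]^n V) :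
    coef b (List.ofFn m) (TensorPower.toTensorAlgebra u) =
      (Basis.piTensorProduct (fun _ : Fin n => b)).coord m u := by
  classical
  have : coef b (List.ofFn m) ∘ₗ TensorPower.toTensorAlgebra =
      (Basis.piTensorProduct (fun _ : Fin n => b)).coord m := by
    refine (Basis.piTensorProduct (fun _ : Fin n => b)).ext fun k => ?_
    rw [LinearMap.comp_apply, toTensorAlgebra_piTensorProduct, coef_wordBasis,
      Module.Basis.coord_apply, Module.Basis.repr_self, Finsupp.single_apply]
    simp
  exact LinearMap.congr_fun this u

theorem coef_toTensorAlgebra_of_length_ne {n : ℕ} {l : List I} (hl : l.length ≠ n)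
    (u : ⨂[K]^n V) : coef b l (TensorPower.toTensorAlgebra u) = 0 := by
  classical
  have : coef b l ∘ₗ (TensorPower.toTensorAlgebra (n := n)) = 0 := by
    refine (Basis.piTensorProduct (fun _ : Fin n => b)).ext fun k => ?_
    rw [LinearMap.comp_apply, toTensorAlgebra_piTensorProduct, coef_wordBasis, if_neg]
    · rfl
    · rintro rfl
      simp at hl
  exact LinearMap.congr_fun this u

theorem coord_reindex {n : ℕ} (σ : Equiv.Perm (Fin n)) (m : Fin n → I) (u : ⨂[K]^n V) :
    (Basis.piTensorProduct (fun _ : Fin n => b)).coord m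
        (PiTensorProduct.reindex K (fun _ : Fin n => V) σ u) =
      (Basis.piTensorProduct (fun _ : Fin n => b)).coord (m ∘ σ) u := by
  classical
  have : (Basis.piTensorProduct (fun _ : Fin n => b)).coord m ∘ₗ
        (PiTensorProduct.reindex K (fun _ : Fin n => V) σ).toLinearMap =
      (Basis.piTensorProduct (fun _ : Fin n => b)).coord (m ∘ σ) := by
    refine (Basis.piTensorProduct (fun _ : Fin n => b)).ext fun k => ?_
    have h : PiTensorProduct.reindex K (fun _ : Fin n => V) σ
        (Basis.piTensorProduct (fun _ : Fin n => b) k) =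
        Basis.piTensorProduct (fun _ : Fin n => b) (k ∘ σ.symm) := by
      rw [Basis.piTensorProduct_apply, Basis.piTensorProduct_apply, PiTensorProduct.reindex_tprod]
      rfl
    rw [LinearMap.comp_apply, LinearEquiv.coe_coe, h]
    simp only [Module.Basis.coord_apply, Module.Basis.repr_self, Finsupp.single_apply]
    refine if_congr ?_ rfl rfl
    constructor
    · rintro rfl; ext; simp
    · rintro rfl; ext; simp
  exact LinearMap.congr_fun this u

/-- The terms of an element of the tensor algebra that have a given degree. -/
theorem exists_component (t : TensorAlgebra K V) (n : ℕ) :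
    ∃ u : ⨂[K]^n V, ∀ m : Fin n → I,
      (Basis.piTensorProduct (fun _ : Fin n => b)).coord m u = coef b (List.ofFn m) t := by
  classical
  let c : (Fin n → I) →₀ K := ((wordBasis b).repr t).comapDomain List.ofFn
    (List.ofFn_injective.injOn)
  refine ⟨(Basis.piTensorProduct (fun _ : Fin n => b)).repr.symm c, fun m => ?_⟩
  simp [c, coef]

/-- Permuted words have the same letter multiplicities, so the fibres of `k` and `m` over each
letter are equinumerous; bijections of fibres glue to `σ`. -/
theorem exists_comp_eq_of_perm_ofFn {n : ℕ} {m k : Fin n → I}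
    (h : (List.ofFn m).Perm (List.ofFn k)) : ∃ σ : Equiv.Perm (Fin n), m ∘ σ = k := by
  classical
  have hc : ∀ a, Fintype.card {i // k i = a} = Fintype.card {i // m i = a} := by
    intro a
    have h1 : (Finset.univ.val.map k).count a = (Finset.univ.val.map m).count a := by
      rw [Fin.univ_val_map, Fin.univ_val_map, Multiset.coe_eq_coe.2 h]
    simp only [Multiset.count_map] at h1
    simp only [Fintype.card_subtype, Finset.card_def, Finset.filter_val]
    simpa only [eq_comm] using h1
  refine ⟨Equiv.ofFiberEquiv (f := k) (g := m) fun a => Fintype.equivOfCardEq (hc a), ?_⟩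
  ext i
  exact Equiv.ofFiberEquiv_map _ i

/-- `Σₙ` permutes the word basis in degree `n`, so invariance means that coefficients are constant
on orbits of words. For the converse, `t` is the sum of its homogeneous components, finitely many of
which are nonzero. -/
theorem mem_symmetricTensors_iff (t : TensorAlgebra K V) :
    t ∈ symmetricTensors K V ↔ ∀ l l' : List I, l.Perm l' → coef b l t = coef b l' t := by
  classical
  constructor
  · intro ht l l' hl
    refine Submodule.iSup_induction (motive := fun t => coef b l t = coef b l' t) _ ht ?_ ?_ ?_
    · rintro n _ ⟨u, hu, rfl⟩
      by_cases h : l.length = n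
      · subst h
        obtain ⟨m, hm⟩ : ∃ m : Fin l.length → I, List.ofFn m = l' := by
          rw [hl.length_eq]; exact ⟨l'.get, List.ofFn_get l'⟩
        obtain ⟨σ, hσ⟩ := exists_comp_eq_of_perm_ofFn
          (m := l.get) (k := m) (by rwa [List.ofFn_get, hm])
        have h1 := coef_toTensorAlgebra_ofFn b l.get u
        have h2 := (Submodule.mem_iInf _).1 hu σ
        rw [LinearMap.mem_eqLocus, LinearEquiv.coe_coe, LinearMap.id_apply] at h2
        rw [← h2, coord_reindex, hσ, List.ofFn_get, h2] at h1
        rw [h1, ← hm, coef_toTensorAlgebra_ofFn]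
      · rw [coef_toTensorAlgebra_of_length_ne b h,
          coef_toTensorAlgebra_of_length_ne b (hl.length_eq ▸ h)]
    · simp
    · intro x y hx hy
      rw [map_add, map_add, hx, hy]
  · intro h
    choose u hu using exists_component b t
    have ht : t = ∑ n ∈ ((wordBasis b).repr t).support.image List.length,
        TensorPower.toTensorAlgebra (u n) := by
      refine ext_coef (b := b) fun l => ?_
      rw [map_sum]
      have h1 : ∀ n, n ≠ l.length → coef b l (TensorPower.toTensorAlgebra (u n)) = 0 :=
        fun n hn => coef_toTensorAlgebra_of_length_ne b hn.symm _
      have h2 : coef b l (TensorPower.toTensorAlgebra (u l.length)) = coef b l t := by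
        have := coef_toTensorAlgebra_ofFn b l.get (u l.length)
        rw [hu, List.ofFn_get] at this
        exact this
      rw [Finset.sum_eq_single l.length (fun n _ hn => h1 n hn), h2]
      intro hl
      rw [h2]
      by_contra h0
      exact hl (Finset.mem_image_of_mem _ (Finsupp.mem_support_iff.2 h0))
    rw [ht]
    refine Submodule.sum_mem _ fun n _ => Submodule.mem_iSup_of_mem n ⟨u n, ?_, rfl⟩
    refine (Submodule.mem_iInf _).2 fun σ => ?_
    rw [LinearMap.mem_eqLocus]
    refine (Basis.piTensorProduct (fun _ : Fin n => b)).ext_elem fun m => ?_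
    have := coord_reindex b σ m (u n)
    rw [hu] at this
    have h3 := hu n m
    simp only [Module.Basis.coord_apply] at this h3
    rw [LinearEquiv.coe_coe, LinearMap.id_apply, this, h3]
    exact h _ _ (σ.ofFn_comp_perm m)

end TensorCoordinates

/-! ### Maps from a conilpotent coalgebra to the tensor coalgebra. -/

section Conilpotent

variable {K : Type w} [Field K]

theorem exists_comp_eq_of_ker_le_ker {E F G : Type*} [AddCommGroup E] [Module K E]
    [AddCommGroup F] [Module K F] [AddCommGroup G] [Module K G] (g : E →ₗ[K] F) (h : E →ₗ[K] G)
    (hk : ∀ x, g x = 0 → h x = 0) : ∃ k : F →ₗ[K] G, k ∘ₗ g = h := by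
  have hle : LinearMap.ker g ≤ LinearMap.ker h := hk
  obtain ⟨k, hk'⟩ := LinearMap.exists_extend
    ((LinearMap.ker g).liftQ h hle ∘ₗ g.quotKerEquivRange.symm.toLinearMap)
  refine ⟨k, LinearMap.ext fun x => ?_⟩
  have h1 := LinearMap.congr_fun hk' ⟨g x, LinearMap.mem_range_self g x⟩
  have h2 : g.quotKerEquivRange.symm ⟨g x, LinearMap.mem_range_self g x⟩ =
      (LinearMap.ker g).mkQ x := by
    rw [LinearEquiv.symm_apply_eq]; rfl
  simp only [LinearMap.comp_apply, LinearEquiv.coe_coe, h2] at h1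
  exact h1

theorem tensorMap_sub_right {E F G H : Type*} [AddCommGroup E] [Module K E] [AddCommGroup F]
    [Module K F] [AddCommGroup G] [Module K G] [AddCommGroup H] [Module K H]
    (g : E →ₗ[K] F) (h k : G →ₗ[K] H) :
    TensorProduct.map g (h - k) = TensorProduct.map g h - TensorProduct.map g k := by
  rw [eq_sub_iff_add_eq, ← TensorProduct.map_add_right, sub_add_cancel]

theorem tensor_eq_zero_of_forall_dual {E F : Type*} [AddCommGroup E] [Module K E]
    [AddCommGroup F] [Module K F] (z : E ⊗[K] F)
    (h : ∀ φ : E →ₗ[K] K, TensorProduct.lid K F (φ.rTensor F z) = 0) : z = 0 := by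
  let bE := Module.Basis.ofVectorSpace K E
  let bF := Module.Basis.ofVectorSpace K F
  refine (bE.tensorProduct bF).ext_elem fun ⟨i, j⟩ => ?_
  have h1 := congrArg (bF.coord j) (h (bE.coord i))
  have h2 : bF.coord j ∘ₗ (TensorProduct.lid K F).toLinearMap ∘ₗ (bE.coord i).rTensor F =
      (bE.tensorProduct bF).coord (i, j) := by
    ext x y
    simp [mul_comm]
  have h3 := LinearMap.congr_fun h2 z
  simp only [LinearMap.comp_apply, LinearEquiv.coe_coe] at h3
  rw [h3] at h1
  simpa using h1

/-- Iterated comultiplications take values in the tensor algebra; this recovers the tensor `(δⁿ ⊗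
id) δ c` from its product there. -/
theorem mul_ι_injective {V : Type*} [AddCommGroup V] [Module K V] :
    Function.Injective (LinearMap.mul' K (TensorAlgebra K V) ∘ₗ
      TensorProduct.map LinearMap.id (TensorAlgebra.ι K)) := by
  let b := Module.Basis.ofVectorSpace K V
  -- A left inverse: split off the last letter of a word. The value at the empty word is irrelevant.
  let L : TensorAlgebra K V →ₗ[K] TensorAlgebra K V ⊗[K] V := (wordBasis b).constr K fun l =>
    if h : l = [] then 0 else wordBasis b l.dropLast ⊗ₜ b (l.getLast h)
  refine Function.LeftInverse.injective (g := L) fun z => ?_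
  have : L ∘ₗ (LinearMap.mul' K (TensorAlgebra K V) ∘ₗ
      TensorProduct.map LinearMap.id (TensorAlgebra.ι K)) = LinearMap.id := by
    refine ((wordBasis b).tensorProduct b).ext fun ⟨l, i⟩ => ?_
    have h : wordBasis b l * TensorAlgebra.ι K (b i) = wordBasis b (l ++ [i]) := by
      simp [wordBasis_append, wordBasis_cons, wordBasis_nil]
    simp [h, L, Module.Basis.constr_basis]
  exact LinearMap.congr_fun this z

variable {D : Type*} [AddCommGroup D] [Module K D] {δ : D →ₗ[K] D ⊗[K] D}

theorem map_iterComul_eq_zero {n : ℕ} {c : D} (hc : iterComul δ (n + 1) c = 0) :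
    TensorProduct.map (iterComul δ n) LinearMap.id (δ c) = 0 := by
  apply mul_ι_injective
  rw [map_zero, ← hc]
  simp only [iterComul, LinearMap.comp_apply, ← TensorProduct.map_comp,
    ← LinearMap.comp_apply (TensorProduct.map _ _) (TensorProduct.map _ _),
    LinearMap.id_comp, LinearMap.comp_id]

/-- Over a field, a map vanishing on `ker δⁿ` factors through `δⁿ`. This is the induction step along
the filtration by the kernels of the `δⁿ`. -/
theorem map_comul_eq_zero_left {E F : Type*} [AddCommGroup E] [Module K E]
    [AddCommGroup F] [Module K F] {n : ℕ} {c : D} (hc : iterComul δ (n + 1) c = 0)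
    (h : D →ₗ[K] E) (hh : ∀ x, iterComul δ n x = 0 → h x = 0) (g : D →ₗ[K] F) :
    TensorProduct.map h g (δ c) = 0 := by
  obtain ⟨k, rfl⟩ := exists_comp_eq_of_ker_le_ker _ h hh
  have := congrArg (TensorProduct.map k g) (map_iterComul_eq_zero hc)
  rwa [map_zero, ← LinearMap.comp_apply, ← TensorProduct.map_comp, LinearMap.comp_id] at this

theorem map_comul_comm (hδ : IsCocommutative δ) {E F : Type*} [AddCommGroup E] [Module K E]
    [AddCommGroup F] [Module K F] (g : D →ₗ[K] E) (h : D →ₗ[K] F) (c : D) :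
    TensorProduct.comm K E F (TensorProduct.map g h (δ c)) = TensorProduct.map h g (δ c) := by
  conv_rhs => rw [← hδ]
  rw [LinearMap.comp_apply, LinearEquiv.coe_coe]
  generalize δ c = z
  induction z with
  | zero => simp
  | add x y hx hy => simp only [map_add, hx, hy]
  | tmul x y => simp

theorem map_comul_eq_zero_right (hδ : IsCocommutative δ) {E F : Type*} [AddCommGroup E]
    [Module K E] [AddCommGroup F] [Module K F] {n : ℕ} {c : D}
    (hc : iterComul δ (n + 1) c = 0) (h : D →ₗ[K] E) (hh : ∀ x, iterComul δ n x = 0 → h x = 0)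
    (g : D →ₗ[K] F) : TensorProduct.map g h (δ c) = 0 := by
  rw [← map_comul_comm hδ, map_comul_eq_zero_left hc h hh, map_zero]

/-- A homogeneous recursion along `δ` has only the zero solution: if `h` kills `ker δⁿ`, the
recursion makes it kill `ker δⁿ⁺¹`, and these kernels exhaust `D`. Applied to differences, it proves
uniqueness statements. -/
theorem IsConilpotentComCoalgebra.eq_zero_of_recursion (hδ : IsConilpotentComCoalgebra δ)
    {E F : Type*} [AddCommGroup E] [Module K E] [AddCommGroup F] [Module K F]
    (m : F ⊗[K] E →ₗ[K] E) (g : D →ₗ[K] F) (h : D →ₗ[K] E)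
    (hh : ∀ c, h c = m (TensorProduct.map g h (δ c))) (c : D) : h c = 0 := by
  have key : ∀ n c, iterComul δ n c = 0 → h c = 0 := by
    intro n
    induction n with
    | zero =>
      intro c hc
      rw [(TensorAlgebra.ι_eq_zero_iff K c).1 hc, map_zero]
    | succ n ih =>
      intro c hc
      rw [hh, map_comul_eq_zero_right hδ.cocomm hc h ih, map_zero]
  obtain ⟨N, hN⟩ := hδ.conilpotent c
  exact key (N + 1) c (hN _ N.lt_succ_self)

variable {V : Type*} [AddCommGroup V] [Module K V] (δ) (f : D →ₗ[K] V)

/-- The component of degree `n + 1` of the morphism to the tensor coalgebra induced by `f`. -/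
def liftComponent : ℕ → D →ₗ[K] TensorAlgebra K V
  | 0 => TensorAlgebra.ι K ∘ₗ f
  | n + 1 => LinearMap.mul' K (TensorAlgebra K V) ∘ₗ
      TensorProduct.map (TensorAlgebra.ι K ∘ₗ f) (liftComponent n) ∘ₗ δ

variable {δ}

theorem liftComponent_eq_zero (hδ : IsCocommutative δ) (n : ℕ) (c : D)
    (hc : iterComul δ n c = 0) : liftComponent δ f n c = 0 := by
  induction n generalizing c with
  | zero => rw [(TensorAlgebra.ι_eq_zero_iff K c).1 hc, map_zero]
  | succ n ih =>
    simp only [liftComponent, LinearMap.comp_apply]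
    rw [map_comul_eq_zero_right hδ hc _ ih, map_zero]

theorem IsConilpotentComCoalgebra.finite_support (hδ : IsConilpotentComCoalgebra δ) (c : D) :
    (Function.support fun n => liftComponent δ f n c).Finite := by
  obtain ⟨N, hN⟩ := hδ.conilpotent c
  refine (Set.finite_Iic N).subset fun n hn => ?_
  by_contra h
  exact hn (liftComponent_eq_zero f hδ.cocomm n c (hN n (not_le.1 h)))

/-- The morphism from a conilpotent coalgebra to the tensor coalgebra induced by a linear map. -/
def IsConilpotentComCoalgebra.lift (hδ : IsConilpotentComCoalgebra δ) :
    D →ₗ[K] TensorAlgebra K V where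
  toFun c := ∑ᶠ n, liftComponent δ f n c
  map_add' x y := by
    simp only [map_add]
    exact finsum_add_distrib (hδ.finite_support f x) (hδ.finite_support f y)
  map_smul' a x := by
    simp only [map_smul, RingHom.id_apply]
    exact (smul_finsum' a (hδ.finite_support f x)).symm

variable (hδ : IsConilpotentComCoalgebra δ)

theorem lift_eventually (c : D) : ∀ᶠ M in Filter.atTop,
    hδ.lift f c = ∑ n ∈ Finset.range M, liftComponent δ f n c := by
  obtain ⟨N, hN⟩ := hδ.conilpotent c
  filter_upwards [Filter.eventually_gt_atTop N] with M hM
  refine finsum_eq_sum_of_support_subset _ fun n hn => ?_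
  by_contra h
  simp only [Finset.coe_range, Set.mem_Iio, not_lt] at h
  exact hn (liftComponent_eq_zero f hδ.cocomm n c (hN n (hM.trans_le h)))

theorem map_lift_eventually (g : D →ₗ[K] TensorAlgebra K V) (z : D ⊗[K] D) :
    ∀ᶠ M in Filter.atTop, TensorProduct.map g (hδ.lift f) z =
      ∑ n ∈ Finset.range M, TensorProduct.map g (liftComponent δ f n) z := by
  induction z with
  | zero => simp
  | add x y hx hy =>
    filter_upwards [hx, hy] with M h1 h2
    simp only [map_add, h1, h2, Finset.sum_add_distrib]
  | tmul x y =>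
    filter_upwards [lift_eventually f hδ y] with M h
    simp only [TensorProduct.map_tmul, h, TensorProduct.tmul_sum]

/-- The degree-one term plus the recursion of `liftComponent` summed over all degrees. By
`lift_unique` this equation characterises the lift. -/
theorem lift_apply (c : D) :
    hδ.lift f c = TensorAlgebra.ι K (f c) +
      LinearMap.mul' K _ (TensorProduct.map (TensorAlgebra.ι K ∘ₗ f) (hδ.lift f) (δ c)) := by
  -- The sum on the left is cut at `M + 1` and the one on the right at `M`, since prefixing a letter
  -- raises the degree by one.
  obtain ⟨M, h1, h2⟩ := (((Filter.tendsto_add_atTop_nat 1).eventually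
    (lift_eventually f hδ c)).and
      (map_lift_eventually f hδ (TensorAlgebra.ι K ∘ₗ f) (δ c))).exists
  rw [h1, h2, Finset.sum_range_succ', map_sum, add_comm]
  rfl

theorem algebraMapInv_mul_ι_map (h : D →ₗ[K] TensorAlgebra K V) (z : D ⊗[K] D) :
    TensorAlgebra.algebraMapInv (LinearMap.mul' K _
      (TensorProduct.map (TensorAlgebra.ι K ∘ₗ f) h z)) = 0 := by
  induction z with
  | zero => simp
  | add x y hx hy => simp only [map_add, hx, hy, add_zero]
  | tmul x y => simp [TensorAlgebra.algebraMapInv]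

theorem algebraMapInv_lift (c : D) : TensorAlgebra.algebraMapInv (hδ.lift f c) = 0 := by
  rw [lift_apply, map_add, algebraMapInv_mul_ι_map]
  simp [TensorAlgebra.algebraMapInv]

theorem degreeOne_lift (c : D) : degreeOne K V (hδ.lift f c) = f c := by
  rw [lift_apply, map_add, degreeOne_ι, add_eq_left]
  generalize δ c = z
  induction z with
  | zero => simp
  | add x y hx hy => simp only [map_add, hx, hy, add_zero]
  | tmul x y => simp [degreeOne_ι_mul, algebraMapInv_lift]

theorem lift_unique (h : D →ₗ[K] TensorAlgebra K V)
    (hh : ∀ c, h c = TensorAlgebra.ι K (f c) +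
      LinearMap.mul' K _ (TensorProduct.map (TensorAlgebra.ι K ∘ₗ f) h (δ c))) :
    h = hδ.lift f := by
  rw [← sub_eq_zero]
  refine LinearMap.ext (hδ.eq_zero_of_recursion (LinearMap.mul' K _) (TensorAlgebra.ι K ∘ₗ f) _
    fun c => ?_)
  rw [LinearMap.sub_apply, hh, lift_apply, tensorMap_sub_right, LinearMap.sub_apply,
    map_sub]
  abel

/-- With `R` the right-hand side, both sides satisfy the same inhomogeneous recursion, so their
difference satisfies a homogeneous one and vanishes. For the left side this is `deconcat_ι_mul`; for
`R` it uses coassociativity of `δ`. -/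
theorem deconcat_lift (c : D) :
    deconcat K V (hδ.lift f c) = hδ.lift f c ⊗ₜ 1 + 1 ⊗ₜ hδ.lift f c +
      TensorProduct.map (hδ.lift f) (hδ.lift f) (δ c) := by
  set Ψ := hδ.lift f with hΨ
  let R : D →ₗ[K] TensorAlgebra K V ⊗[K] TensorAlgebra K V :=
    (TensorProduct.mk K _ _).flip 1 ∘ₗ Ψ + TensorProduct.mk K _ _ 1 ∘ₗ Ψ + TensorProduct.map Ψ Ψ ∘ₗ δ
  let g : D →ₗ[K] TensorAlgebra K V ⊗[K] TensorAlgebra K V :=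
    (TensorProduct.mk K _ _).flip 1 ∘ₗ TensorAlgebra.ι K ∘ₗ f
  have hR : ∀ c, R c = Ψ c ⊗ₜ 1 + 1 ⊗ₜ Ψ c + TensorProduct.map Ψ Ψ (δ c) := fun _ => rfl
  let m := LinearMap.mul' K (TensorAlgebra K V ⊗[K] TensorAlgebra K V)
  have e1 : ∀ z, deconcat K V (LinearMap.mul' K _
        (TensorProduct.map (TensorAlgebra.ι K ∘ₗ f) Ψ z)) =
      1 ⊗ₜ (LinearMap.mul' K _ (TensorProduct.map (TensorAlgebra.ι K ∘ₗ f) Ψ z)) +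
        m (TensorProduct.map g (deconcat K V ∘ₗ Ψ) z) := by
    intro z
    induction z with
    | zero => simp
    | add x y hx hy => simp only [map_add, hx, hy, TensorProduct.tmul_add]; abel
    | tmul x y => simp [deconcat_ι_mul, m, g]
  have e2 : ∀ z, m (TensorProduct.map g ((TensorProduct.mk K _ _).flip 1 ∘ₗ Ψ) z) =
      (LinearMap.mul' K _ (TensorProduct.map (TensorAlgebra.ι K ∘ₗ f) Ψ z)) ⊗ₜ 1 := by
    intro z
    induction z with
    | zero => simp
    | add x y hx hy => simp only [map_add, hx, hy, TensorProduct.add_tmul]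
    | tmul x y => simp [m, g]
  have e3 : ∀ z, m (TensorProduct.map g (TensorProduct.mk K _ _ 1 ∘ₗ Ψ) z) =
      TensorProduct.map (TensorAlgebra.ι K ∘ₗ f) Ψ z := by
    intro z
    induction z with
    | zero => simp
    | add x y hx hy => simp only [map_add, hx, hy]
    | tmul x y => simp [m, g]
  let N : (D ⊗[K] D) ⊗[K] D →ₗ[K] TensorAlgebra K V ⊗[K] TensorAlgebra K V := TensorProduct.map
    (LinearMap.mul' K _ ∘ₗ TensorProduct.map (TensorAlgebra.ι K ∘ₗ f) Ψ) Ψ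
  have e4 : ∀ z, m (TensorProduct.map g (TensorProduct.map Ψ Ψ ∘ₗ δ) z) =
      N ((TensorProduct.assoc K D D D).symm (δ.lTensor D z)) := by
    have e5 : ∀ (x : D) (y : D ⊗[K] D), m (g x ⊗ₜ TensorProduct.map Ψ Ψ y) =
        N ((TensorProduct.assoc K D D D).symm (x ⊗ₜ y)) := by
      intro x y
      induction y with
      | zero => simp
      | add y y' hx hy => simp only [map_add, hx, hy, TensorProduct.tmul_add]
      | tmul x y => simp [m, g, N]
    intro z
    induction z with
    | zero => simp
    | add x y hx hy => simp only [map_add, hx, hy]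
    | tmul x y => exact e5 x (δ y)
  have e6 : ∀ z, N (δ.rTensor D z) = TensorProduct.map (LinearMap.mul' K _ ∘ₗ
      TensorProduct.map (TensorAlgebra.ι K ∘ₗ f) Ψ ∘ₗ δ) Ψ z := by
    intro z
    simp only [N, LinearMap.rTensor]
    rw [← LinearMap.comp_apply, ← TensorProduct.map_comp, LinearMap.comp_id]
    rfl
  suffices h : deconcat K V ∘ₗ Ψ - R = 0 by
    have := LinearMap.congr_fun h c
    rw [LinearMap.sub_apply, LinearMap.zero_apply, sub_eq_zero] at this
    exact this
  refine LinearMap.ext (hδ.eq_zero_of_recursion m g _ fun c => ?_)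
  have hco : δ.lTensor D (δ c) = TensorProduct.assoc K D D D (δ.rTensor D (δ c)) :=
    (LinearMap.congr_fun hδ.coassoc c).symm
  -- Expand the first factor `Ψ` by its recursion; coassociativity moves the inner `δ` to the second
  -- factor.
  have h1 : TensorProduct.map Ψ Ψ (δ c) =
      TensorProduct.map (TensorAlgebra.ι K ∘ₗ f) Ψ (δ c) +
        m (TensorProduct.map g (TensorProduct.map Ψ Ψ ∘ₗ δ) (δ c)) := by
    rw [e4, hco, LinearEquiv.symm_apply_apply, e6, ← LinearMap.add_apply,
      ← TensorProduct.map_add_left]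
    congr 2
    ext c
    simpa using lift_apply f hδ c
  have h2 := lift_apply f hδ c
  rw [← hΨ] at h2
  have hs : ∀ h k : D →ₗ[K] TensorAlgebra K V ⊗[K] TensorAlgebra K V, ∀ z,
      m (TensorProduct.map g (h - k) z) =
        m (TensorProduct.map g h z) - m (TensorProduct.map g k z) := by
    intro h k z
    induction z with
    | zero => simp
    | add x y hx hy => simp only [map_add, hx, hy]; abel
    | tmul x y => simp [m, mul_sub]
  rw [LinearMap.sub_apply, hs, LinearMap.comp_apply, hR, h1]
  simp only [R, TensorProduct.map_add_right, LinearMap.add_apply, map_add]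
  rw [e2, e3, h2, map_add, e1, deconcat_ι]
  simp only [TensorProduct.add_tmul, TensorProduct.tmul_add]
  abel

/-- The coefficient of a concatenation of nonempty words is the convolution product of the
coefficients along `δ`. Convolution is commutative because `δ` is cocommutative, so two adjacent
letters may be exchanged. -/
theorem lift_perm {I : Type*} (b : Module.Basis I K V) (l l' : List I) (hl : l.Perm l') :
    coef b l ∘ₗ hδ.lift f = coef b l' ∘ₗ hδ.lift f := by
  set Ψ := hδ.lift f with hΨ
  have h0 : coef b [] ∘ₗ Ψ = 0 := by
    ext c; rw [coef_nil]; exact algebraMapInv_lift f hδ c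
  -- Nonempty words are needed so that the terms `Ψ c ⊗ 1` and `1 ⊗ Ψ c` of `deconcat_lift` do not
  -- contribute.
  have happ : ∀ l m : List I, l ≠ [] → m ≠ [] →
      coef b (l ++ m) ∘ₗ Ψ = pairing (coef b l ∘ₗ Ψ) (coef b m ∘ₗ Ψ) ∘ₗ δ := by
    intro l m hl hm
    obtain ⟨i, l, rfl⟩ := List.exists_cons_of_ne_nil hl
    obtain ⟨j, m, rfl⟩ := List.exists_cons_of_ne_nil hm
    ext c
    rw [LinearMap.comp_apply, coef_append, hΨ, deconcat_lift]
    simp only [pairing, LinearMap.comp_apply, map_add, TensorProduct.map_tmul, coef_cons_one,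
      TensorProduct.tmul_zero, TensorProduct.zero_tmul, map_zero, zero_add, TensorProduct.map_comp]
  have hcomm : ∀ φ ψ : D →ₗ[K] K, pairing φ ψ ∘ₗ δ = pairing ψ φ ∘ₗ δ := by
    intro φ ψ
    ext c
    simp only [pairing, LinearMap.comp_apply]
    rw [← map_comul_comm hδ.cocomm φ ψ c]
    generalize TensorProduct.map φ ψ (δ c) = z
    induction z with
    | zero => simp
    | add x y hx hy => simp only [map_add, hx, hy]
    | tmul x y => simp [mul_comm]
  induction hl with
  | nil => rfl
  | @cons i l l' h ih =>
    by_cases hl : l = []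
    · subst hl; rw [h.nil_eq]
    · have hl' : l' ≠ [] := fun h' => hl (by subst h'; exact h.eq_nil)
      rw [← List.singleton_append, happ _ _ (by simp) hl, ih, ← happ _ _ (by simp) hl']
      rfl
  | swap i j l =>
    have h2 : coef b [j, i] ∘ₗ Ψ = coef b [i, j] ∘ₗ Ψ := by
      rw [← List.singleton_append, happ _ _ (by simp) (by simp), hcomm,
        ← happ _ _ (by simp) (by simp)]
      rfl
    by_cases hl : l = []
    · subst hl; exact h2
    · have e : ∀ i j, i :: j :: l = [i, j] ++ l := fun _ _ => rfl
      rw [e, e, happ _ _ (by simp) hl, happ _ _ (by simp) hl, h2]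
  | trans _ _ h1 h2 => exact h1.trans h2

theorem lift_mem_symmetricTensors (c : D) : hδ.lift f c ∈ symmetricTensors K V :=
  (mem_symmetricTensors_iff (Module.Basis.ofVectorSpace K V) _).2 fun l l' h =>
    LinearMap.congr_fun (lift_perm f hδ _ l l' h) c

end Conilpotent

/-! ### Injectivity of the lift. -/

section LiftInjective

variable {K : Type w} [Field K] {D V : Type*} [AddCommGroup D] [Module K D]
  [AddCommGroup V] [Module K V] {δ : D →ₗ[K] D ⊗[K] D} (f : D →ₗ[K] V)
  (hδ : IsConilpotentComCoalgebra δ)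

theorem map_lid_rTensor {E F G : Type*} [AddCommGroup E] [Module K E] [AddCommGroup F] [Module K F]
    [AddCommGroup G] [Module K G] (φ : G →ₗ[K] K) (L : E →ₗ[K] F) (z : G ⊗[K] E) :
    L (TensorProduct.lid K E (φ.rTensor E z)) =
      TensorProduct.lid K F (φ.rTensor F (TensorProduct.map LinearMap.id L z)) := by
  induction z with
  | zero => simp
  | add x y hx hy => simp only [map_add, hx, hy]
  | tmul x y => simp

theorem map_id_map {E F G H : Type*} [AddCommGroup E] [Module K E] [AddCommGroup F] [Module K F]
    [AddCommGroup G] [Module K G] [AddCommGroup H] [Module K H]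
    (g : E →ₗ[K] F) (h : G →ₗ[K] H) (z : E ⊗[K] G) :
    TensorProduct.map LinearMap.id h (TensorProduct.map g LinearMap.id z) =
      TensorProduct.map g h z := by
  rw [← LinearMap.comp_apply, ← TensorProduct.map_comp, LinearMap.id_comp, LinearMap.comp_id]

/-- Injectivity on primitives suffices. Let `Ψ` be the lift and suppose `Ψ c = 0` with `δⁿ⁺¹ c = 0`.
Then `(Ψ ⊗ Ψ) δ c = 0`, and contracting one factor with a functional leaves an element of `ker δⁿ`,
where `Ψ` is injective by induction. Cancelling `Ψ` in one factor and then in the other gives `δ c =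
0`. -/
theorem lift_injective (hf : ∀ c, δ c = 0 → f c = 0 → c = 0) :
    Function.Injective (hδ.lift f) := by
  have key : ∀ n c, iterComul δ n c = 0 → hδ.lift f c = 0 → c = 0 := by
    intro n
    induction n with
    | zero => exact fun c hc _ => (TensorAlgebra.ι_eq_zero_iff K c).1 hc
    | succ n ih =>
      intro c hc h0
      have h1 : TensorProduct.map (hδ.lift f) (hδ.lift f) (δ c) = 0 := by
        have := deconcat_lift f hδ c
        rw [h0] at this
        simpa using this.symm
      have h2 : TensorProduct.map (hδ.lift f) LinearMap.id (δ c) = 0 := by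
        refine tensor_eq_zero_of_forall_dual _ fun φ => ih _ ?_ ?_
        · rw [map_lid_rTensor, map_id_map, map_comul_eq_zero_right hδ.cocomm hc _ fun _ h => h,
            map_zero, map_zero]
        · rw [map_lid_rTensor, map_id_map, h1, map_zero, map_zero]
      have h3 : δ c = 0 := by
        refine tensor_eq_zero_of_forall_dual _ fun φ => ih _ ?_ ?_
        · rw [map_lid_rTensor, map_comul_eq_zero_right hδ.cocomm hc _ fun _ h => h,
            map_zero, map_zero]
        · rw [map_lid_rTensor, ← map_comul_comm hδ.cocomm, h2, map_zero, map_zero, map_zero]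
      refine hf c h3 ?_
      rw [← degreeOne_lift f hδ, h0, map_zero]
  rw [injective_iff_map_eq_zero]
  intro c hc
  obtain ⟨N, hN⟩ := hδ.conilpotent c
  exact key (N + 1) c (hN _ N.lt_succ_self) hc

end LiftInjective

/-! ### Unital magmatic bialgebras are cofree on their primitives. -/

section Bialgebra

variable {K : Type w} [Field K] {A : Type u} [AddCommGroup A] [Module K A]

/-- A conilpotent cocommutative coalgebra with a (not necessarily associative) unital
multiplication that is a morphism of coalgebras. -/
structure IsMagmaticBialgebra (e : A) (ε : A →ₗ[K] K) (he : ε e = 1)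
    (Δ : A →ₗ[K] A ⊗[K] A) (μ : A →ₗ[K] A →ₗ[K] A) : Prop where
  coassoc : IsCoassociative Δ
  cocomm : IsCocommutative Δ
  counit_left : (TensorProduct.lid K A).toLinearMap ∘ₗ ε.rTensor A ∘ₗ Δ = LinearMap.id
  counit_right : (TensorProduct.rid K A).toLinearMap ∘ₗ ε.lTensor A ∘ₗ Δ = LinearMap.id
  comul_one : Δ e = e ⊗ₜ[K] e
  conilpotent : IsConilpotentComCoalgebra (reducedComul e ε he Δ)
  one_mul : ∀ a, μ e a = a
  mul_one : ∀ a, μ a e = a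
  counit_mul : ∀ a b, ε (μ a b) = ε a * ε b
  comul_mul : ∀ a b, Δ (μ a b) = TensorProduct.map₂ μ μ (Δ a) (Δ b)

variable {e : A} {ε : A →ₗ[K] K} {he : ε e = 1} {Δ : A →ₗ[K] A ⊗[K] A}

theorem augProj_apply_coe (a : A) : (augProj e ε he a : A) = a - ε a • e := rfl

theorem augProj_one : augProj e ε he e = 0 := by
  ext; simp [augProj_apply_coe, he]

theorem augProj_coe (c : LinearMap.ker ε) : augProj e ε he c = c := by
  have : ε (c : A) = 0 := c.2
  ext; simp [augProj_apply_coe, this]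

theorem eq_smul_add_augProj (a : A) : a = ε a • e + (augProj e ε he a : A) := by
  simp [augProj_apply_coe]

theorem reducedComul_augProj (h1 : Δ e = e ⊗ₜ[K] e) (a : A) :
    reducedComul e ε he Δ (augProj e ε he a) =
      TensorProduct.map (augProj e ε he) (augProj e ε he) (Δ a) := by
  conv_rhs => rw [eq_smul_add_augProj (he := he) a]
  simp [reducedComul, h1, augProj_one]

/-- Applying `ε ⊗ id` to `Δ x = x ⊗ e + e ⊗ x` gives `x = ε(x) e + x`. -/
theorem counit_prim
    (hl : (TensorProduct.lid K A).toLinearMap ∘ₗ ε.rTensor A ∘ₗ Δ = LinearMap.id) (he : ε e = 1)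
    (x : prim e Δ) : ε (x : A) = 0 := by
  have hx : Δ (x : A) = (x : A) ⊗ₜ e + e ⊗ₜ (x : A) := x.2
  have h := LinearMap.congr_fun hl (x : A)
  simp only [LinearMap.comp_apply, LinearEquiv.coe_coe, hx, map_add, LinearMap.rTensor_tmul,
    TensorProduct.lid_tmul, he, one_smul, LinearMap.id_apply, add_eq_right] at h
  simpa [he] using congrArg ε h

variable {μ : A →ₗ[K] A →ₗ[K] A}

namespace IsMagmaticBialgebra

variable (H : IsMagmaticBialgebra e ε he Δ μ) (π : LinearMap.ker ε →ₗ[K] prim e Δ)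

include H

/-- The morphism to the tensor coalgebra on the primitive elements. -/
def toTensor : A →ₗ[K] TensorAlgebra K (prim e Δ) :=
  Algebra.linearMap K (TensorAlgebra K (prim e Δ)) ∘ₗ ε +
    H.conilpotent.lift π ∘ₗ augProj e ε he

theorem toTensor_one : H.toTensor π e = 1 := by
  simp [toTensor, he, augProj_one]

theorem toTensor_coe (c : LinearMap.ker ε) : H.toTensor π c = H.conilpotent.lift π c := by
  have : ε (c : A) = 0 := c.2
  simp [toTensor, augProj_coe, this]

theorem algebraMapInv_toTensor (a : A) : TensorAlgebra.algebraMapInv (H.toTensor π a) = ε a := by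
  rw [toTensor, LinearMap.add_apply, map_add, LinearMap.comp_apply, LinearMap.comp_apply,
    algebraMapInv_lift, add_zero]
  exact TensorAlgebra.algebraMap_leftInverse _ _

theorem comul_coe (c : LinearMap.ker ε) :
    Δ (c : A) = (c : A) ⊗ₜ[K] e + e ⊗ₜ[K] (c : A) +
      TensorProduct.map (LinearMap.ker ε).subtype (LinearMap.ker ε).subtype
        (reducedComul e ε he Δ c) := by
  rw [map_reducedComul e ε he Δ H.counit_left H.counit_right]
  abel

theorem deconcat_toTensor (a : A) : deconcat K (prim e Δ) (H.toTensor π a) =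
    TensorProduct.map (H.toTensor π) (H.toTensor π) (Δ a) := by
  have hc : H.toTensor π ∘ₗ (LinearMap.ker ε).subtype = H.conilpotent.lift π :=
    LinearMap.ext (H.toTensor_coe π)
  rw [eq_smul_add_augProj (he := he) a]
  simp only [map_add, map_smul, toTensor_one, deconcat_one, H.comul_one, TensorProduct.map_tmul]
  congr 1
  rw [toTensor_coe, deconcat_lift, H.comul_coe]
  simp only [map_add, TensorProduct.map_tmul, toTensor_one, toTensor_coe]
  rw [← LinearMap.comp_apply (TensorProduct.map _ _) (TensorProduct.map _ _),
    ← TensorProduct.map_comp, hc]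

theorem toTensor_mem_symmetricTensors (a : A) :
    H.toTensor π a ∈ symmetricTensors K (prim e Δ) := by
  refine add_mem ?_ (lift_mem_symmetricTensors π H.conilpotent _)
  rw [LinearMap.comp_apply, Algebra.linearMap_apply, Algebra.algebraMap_eq_smul_one]
  refine Submodule.smul_mem _ _ ?_
  let b := Module.Basis.ofVectorSpace K (prim e Δ)
  refine (mem_symmetricTensors_iff b _).2 fun l l' hl => ?_
  cases l with
  | nil => rw [hl.nil_eq]
  | cons i l =>
    cases l' with
    | nil => exact absurd hl.eq_nil (by simp)
    | cons j l' => rw [coef_cons_one, coef_cons_one]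

variable (hπ : ∀ (x : prim e Δ) (hx : (x : A) ∈ LinearMap.ker ε), π ⟨x, hx⟩ = x)

include hπ

theorem toTensor_prim (x : prim e Δ) : H.toTensor π (x : A) = TensorAlgebra.ι K x := by
  have hx : (x : A) ∈ LinearMap.ker ε := counit_prim H.counit_left he x
  have h0 : reducedComul e ε he Δ ⟨x, hx⟩ = 0 := by
    have h1 : Δ (x : A) = (x : A) ⊗ₜ e + e ⊗ₜ (x : A) := x.2
    simp [reducedComul, h1, augProj_one]
  rw [H.toTensor_coe π ⟨x, hx⟩, lift_apply, h0, hπ]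
  simp

theorem lift_injective : Function.Injective (H.conilpotent.lift π) := by
  refine PlanarPBW.lift_injective π H.conilpotent fun c h0 h1 => ?_
  -- The kernel of the reduced comultiplication is the space of primitives, on which `π` is the
  -- identity.
  have hc : (c : A) ∈ prim e Δ := by
    have := H.comul_coe c
    rw [h0, map_zero, add_zero] at this
    exact this
  have := hπ ⟨c, hc⟩ c.2
  rw [Subtype.coe_eta, h1] at this
  exact Subtype.ext (congrArg Subtype.val this).symm

theorem toTensor_injective : Function.Injective (H.toTensor π) := by
  rw [injective_iff_map_eq_zero]
  intro a ha
  have h0 : a ∈ LinearMap.ker ε := by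
    rw [LinearMap.mem_ker, ← H.algebraMapInv_toTensor π, ha, map_zero]
  have h1 := H.toTensor_coe π ⟨a, h0⟩
  rw [ha] at h1
  have := H.lift_injective π hπ (h1.symm.trans (map_zero _).symm)
  exact congrArg Subtype.val this

omit hπ in
theorem coef_append_toTensor {I : Type*} (b : Module.Basis I K (prim e Δ)) (m l : List I) (a : A) :
    coef b (m ++ l) (H.toTensor π a) =
      pairing (coef b m ∘ₗ H.toTensor π) (coef b l ∘ₗ H.toTensor π) (Δ a) := by
  rw [coef_append, deconcat_toTensor]
  simp only [pairing, LinearMap.comp_apply, TensorProduct.map_comp]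

-- Since `e` is a left unit for `μ`, multiplying by `x ⊗ e + e ⊗ x` lets `x` act on one tensor
-- factor at a time. This is the source of the shuffle formula.
omit hπ π in
theorem comul_prim_mul (x : prim e Δ) (a : A) :
    Δ (μ x a) = TensorProduct.map (μ x) LinearMap.id (Δ a) +
      TensorProduct.map LinearMap.id (μ x) (Δ a) := by
  have hx : Δ (x : A) = (x : A) ⊗ₜ e + e ⊗ₜ (x : A) := x.2
  rw [H.comul_mul, hx]
  generalize Δ a = z
  induction z with
  | zero => simp
  | add y z hy hz => rw [map_add, hy, hz, map_add, map_add]; abel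
  | tmul y z => simp [H.one_mul]

/-- Up to terms of lower degree, multiplication by a primitive element is the shuffle product. -/
theorem coef_prim_mul {I : Type*} (b : Module.Basis I K (prim e Δ)) (x : prim e Δ) (l : List I)
    (a : A) (ha : ∀ m : List I, l.length ≤ m.length → coef b m (H.toTensor π a) = 0) :
    coef b l (H.toTensor π (μ x a)) =
      ∑ k : Fin l.length, b.coord (l.get k) x * coef b (l.eraseIdx k) (H.toTensor π a) := by
  induction l generalizing a with
  | nil =>
    rw [coef_nil, AlgHom.toLinearMap_apply, algebraMapInv_toTensor, H.counit_mul,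
      counit_prim H.counit_left he]
    simp
  | cons i l ih =>
    set χ : List I → A →ₗ[K] K := fun l => coef b l ∘ₗ H.toTensor π with hχ
    have hnil : χ [] = ε := by
      ext a; simp [hχ, coef_nil, algebraMapInv_toTensor]
    have hone : ∀ j m, χ (j :: m) e = 0 := by
      intro j m; simp [hχ, toTensor_one, coef_cons_one]
    have happ : ∀ m l a, χ (m ++ l) a = pairing (χ m) (χ l) (Δ a) := fun m l a =>
      H.coef_append_toTensor π b m l a
    let p : A →ₗ[K] A := (LinearMap.ker ε).subtype ∘ₗ augProj e ε he
    have hp : ∀ a, a = ε a • e + p a := eq_smul_add_augProj (he := he)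
    -- the part of the first factor of positive degree does not contribute
    have h1 : TensorProduct.rid K A (TensorProduct.map p (χ l) (Δ a)) = 0 := by
      apply H.toTensor_injective π hπ
      rw [map_zero]
      refine ext_coef (b := b) fun m => ?_
      have e1 : ∀ (φ : A →ₗ[K] K) z, φ (TensorProduct.rid K A (TensorProduct.map p (χ l) z)) =
          pairing (φ ∘ₗ p) (χ l) z := by
        intro φ z
        induction z with
        | zero => simp
        | add y z hy hz => simp only [map_add, hy, hz]
        | tmul y z => simp [mul_comm]
      have e2 := e1 (χ m) (Δ a)
      rw [map_zero]
      refine e2.trans ?_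
      cases m with
      | nil =>
        have : χ [] ∘ₗ p = 0 := by
          ext y
          rw [hnil]
          exact (augProj e ε he y).2
        rw [this, pairing, TensorProduct.map_zero_left, LinearMap.comp_zero, LinearMap.zero_apply]
      | cons j m =>
        have : χ (j :: m) ∘ₗ p = χ (j :: m) := by
          ext y
          conv_rhs => rw [hp y]
          rw [map_add, map_smul, hone, smul_zero, zero_add, LinearMap.comp_apply]
        rw [this, ← happ]
        -- The coefficient of `m` in this contraction is that of a word of length at least `l.length
        -- + 1` in `Φ(a)`, which is zero by hypothesis.
        exact ha _ (by simp)
    have h2 : pairing (χ [i]) (χ l) (TensorProduct.map (μ x) LinearMap.id (Δ a)) =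
        χ [i] x * χ l a := by
      have e1 : ∀ z, pairing (χ [i]) (χ l) (TensorProduct.map (μ x) LinearMap.id z) =
          χ [i] x * χ l (TensorProduct.lid K A (ε.rTensor A z)) +
            χ [i] (μ x (TensorProduct.rid K A (TensorProduct.map p (χ l) z))) := by
        intro z
        induction z with
        | zero => simp
        | add y z hy hz => simp only [map_add, hy, hz]; ring
        | tmul y z =>
          have := congrArg (μ x) (hp y)
          rw [map_add, map_smul, H.mul_one] at this
          simp only [pairing, LinearMap.comp_apply, TensorProduct.map_tmul, LinearMap.mul'_apply,
            this, map_add, map_smul, LinearMap.rTensor_tmul, TensorProduct.lid_tmul,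
            TensorProduct.rid_tmul, LinearMap.id_apply, smul_eq_mul]
          ring
      rw [e1, h1, map_zero, map_zero, add_zero]
      have := LinearMap.congr_fun H.counit_left a
      simp only [LinearMap.comp_apply, LinearEquiv.coe_coe, LinearMap.id_apply] at this
      rw [this]
    -- The contraction of `Δ a` by the letter `i`. Its coefficients are those of `a` at words
    -- starting with `i`, so its degree bound drops by one and the induction hypothesis applies.
    let y := TensorProduct.lid K A ((χ [i]).rTensor A (Δ a))
    have hy : ∀ φ : A →ₗ[K] K, φ y = pairing (χ [i]) φ (Δ a) := by
      intro φ
      have : ∀ z, φ (TensorProduct.lid K A ((χ [i]).rTensor A z)) = pairing (χ [i]) φ z := by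
        intro z
        induction z with
        | zero => simp
        | add y z hy hz => simp only [map_add, hy, hz]
        | tmul y z => simp
      exact this _
    have hχy : ∀ m, χ m y = χ (i :: m) a := fun m => by
      rw [hy, ← happ]; rfl
    have h3 : pairing (χ [i]) (χ l) (TensorProduct.map LinearMap.id (μ x) (Δ a)) =
        ∑ k : Fin l.length, b.coord (l.get k) x * χ (i :: l.eraseIdx k) a := by
      have e1 : pairing (χ [i]) (χ l) (TensorProduct.map LinearMap.id (μ x) (Δ a)) =
          χ l (μ x y) := by
        have := hy (χ l ∘ₗ μ x)
        rw [LinearMap.comp_apply] at this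
        rw [this]
        simp only [pairing, LinearMap.comp_apply]
        rw [← LinearMap.comp_apply (TensorProduct.map _ _) (TensorProduct.map _ _),
          ← TensorProduct.map_comp, LinearMap.comp_id]
      rw [e1]
      simp only [← hχy]
      refine ih y fun m hm => ?_
      exact (hχy m).trans (ha (i :: m) (by simpa using hm))
    have h4 : χ (i :: l) (μ x a) = χ [i] x * χ l a +
        ∑ k : Fin l.length, b.coord (l.get k) x * χ (i :: l.eraseIdx k) a := by
      have := happ [i] l (μ x a)
      rw [H.comul_prim_mul, map_add, h2, h3] at this
      exact this
    have h5 : χ [i] x = b.coord i x := by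
      simp [hχ, H.toTensor_prim π hπ, coef_singleton_ι]
    rw [h5] at h4
    refine h4.trans ?_
    exact (Fin.sum_univ_succ (n := l.length) fun k : Fin (l.length + 1) =>
      b.coord ((i :: l).get k) x * χ ((i :: l).eraseIdx k) a).symm

/-- Induction on the degree bound `n`: remove first letters, lift the remainders, multiply back by
the letters, and divide by the number of positions in a top-degree word. -/
theorem mem_range_toTensor [CharZero K] {I : Type*} (b : Module.Basis I K (prim e Δ)) (n : ℕ)
    (t : TensorAlgebra K (prim e Δ)) (ht : t ∈ symmetricTensors K (prim e Δ))
    (hn : ∀ l : List I, n < l.length → coef b l t = 0) : t ∈ LinearMap.range (H.toTensor π) := by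
  classical
  induction n generalizing t with
  | zero =>
    refine ⟨coef b [] t • e, ?_⟩
    rw [map_smul, toTensor_one]
    refine ext_coef (b := b) fun l => ?_
    cases l with
    | nil => simp [coef_nil_one]
    | cons i l => simp [coef_cons_one, hn (i :: l) (by simp)]
  | succ n ih =>
    rw [mem_symmetricTensors_iff b] at ht
    -- `d j` collects the words of `t` that begin with `j`, with that letter removed. It is again
    -- symmetric, of degree at most `n`.
    let d : I → TensorAlgebra K (prim e Δ) := fun j => (wordBasis b).repr.symm
      (((wordBasis b).repr t).comapDomain (List.cons j) (List.cons_injective.injOn))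
    have hd : ∀ j l, coef b l (d j) = coef b (j :: l) t := by
      intro j l; simp [d, coef]
    have hd' : ∀ j, ∃ a, H.toTensor π a = d j := fun j => by
      refine ih (d j) ((mem_symmetricTensors_iff b _).2 fun l l' h => ?_) fun l hl => ?_
      · rw [hd, hd]; exact ht _ _ (h.cons j)
      · rw [hd]; exact hn _ (by simpa using hl)
    choose c hc using hd'
    let J : Finset I := ((wordBasis b).repr t).support.biUnion List.toFinset
    have hJ : ∀ j l, j ∉ J → coef b (j :: l) t = 0 := by
      intro j l hj
      by_contra h
      refine hj (Finset.mem_biUnion.2 ⟨j :: l, Finsupp.mem_support_iff.2 h, by simp⟩)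
    let a : A := ∑ j ∈ J, μ (b j) (c j)
    have ha : ∀ l : List I, n < l.length →
        coef b l (H.toTensor π a) = l.length * coef b l t := by
      intro l hl
      have e1 : ∀ j ∈ J, coef b l (H.toTensor π (μ (b j) (c j))) = ∑ k : Fin l.length,
          if j = l.get k then coef b l t else 0 := by
        intro j _
        rw [H.coef_prim_mul π hπ b]
        · refine Finset.sum_congr rfl fun k _ => ?_
          rw [hc, hd, Module.Basis.coord_apply, Module.Basis.repr_self, Finsupp.single_apply]
          split_ifs with h
          · rw [_root_.one_mul, h]
            -- By symmetry of `t`, moving the `k`-th letter to the front leaves the coefficient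
            -- unchanged, so each position contributes the same amount.
            exact ht _ _ (List.getElem_cons_eraseIdx_perm k.2)
          · rw [zero_mul]
        · intro m hm
          rw [hc, hd]
          exact hn _ (by simp; omega)
      rw [map_sum, map_sum, Finset.sum_congr rfl e1, Finset.sum_comm]
      have e2 : ∀ k : Fin l.length, (∑ j ∈ J, if j = l.get k then coef b l t else 0) =
          coef b l t := by
        intro k
        rw [Finset.sum_ite_eq' J (l.get k)]
        split_ifs with h
        · rfl
        · rw [← ht _ _ (List.getElem_cons_eraseIdx_perm k.2)]
          exact (hJ _ _ h).symm
      rw [Finset.sum_congr rfl fun k _ => e2 k]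
      simp
    -- Words of length `n + 1` cancel and longer words do not occur, so the difference has degree at
    -- most `n`.
    have hs : H.toTensor π a - ((n + 1 : ℕ) : K) • t ∈ LinearMap.range (H.toTensor π) := by
      refine ih _ (sub_mem (H.toTensor_mem_symmetricTensors π a) (Submodule.smul_mem _ _
        ((mem_symmetricTensors_iff b _).2 ht))) fun l hl => ?_
      rw [map_sub, map_smul, ha l hl, smul_eq_mul, ← sub_mul]
      rcases (Nat.succ_le_of_lt hl).eq_or_lt with h | h
      · rw [← h, sub_self, zero_mul]
      · rw [hn l h, mul_zero]
    have h1 : ((n + 1 : ℕ) : K) • t ∈ LinearMap.range (H.toTensor π) := by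
      have := sub_mem (LinearMap.mem_range_self (H.toTensor π) a) hs
      rwa [sub_sub_cancel] at this
    exact (Submodule.smul_mem_iff _ (Nat.cast_ne_zero.2 n.succ_ne_zero)).1 h1

theorem range_toTensor [CharZero K] :
    LinearMap.range (H.toTensor π) = symmetricTensors K (prim e Δ) := by
  refine le_antisymm ?_ fun t ht => ?_
  · rintro _ ⟨a, rfl⟩
    exact H.toTensor_mem_symmetricTensors π a
  · let b := Module.Basis.ofVectorSpace K (prim e Δ)
    refine H.mem_range_toTensor π hπ b (((wordBasis b).repr t).support.sup List.length) t ht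
      fun l hl => ?_
    by_contra h
    have hs : l ∈ ((wordBasis b).repr t).support := Finsupp.mem_support_iff.2 h
    exact absurd (Finset.le_sup (f := List.length) hs) (not_le.2 hl)

/-- The lift of `f` to the tensor coalgebra has symmetric values, hence factors through the
injective `Ψ`. Uniqueness holds because `Ψ ∘ G` satisfies the recursion characterising that lift. -/
theorem hasCofreeProperty [CharZero K] :
    HasCofreeProperty.{u, v, w} (reducedComul e ε he Δ)
      (degreeOne K (prim e Δ) ∘ₗ H.toTensor π ∘ₗ (LinearMap.ker ε).subtype) := by
  have hΦ : H.toTensor π ∘ₗ (LinearMap.ker ε).subtype = H.conilpotent.lift π :=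
    LinearMap.ext (H.toTensor_coe π)
  rw [hΦ]
  set Ψ := H.conilpotent.lift π with hΨ
  have hinj : Function.Injective Ψ := H.lift_injective π hπ
  intro D _ _ δD hD f
  have hrange : ∀ d, ∃ c, Ψ c = hD.lift f d := by
    intro d
    have h1 := lift_mem_symmetricTensors f hD d
    rw [← H.range_toTensor π hπ] at h1
    obtain ⟨a, ha⟩ := h1
    have h2 : ε a = 0 := by
      rw [← H.algebraMapInv_toTensor π, ha, algebraMapInv_lift]
    exact ⟨⟨a, h2⟩, by rw [← ha, ← H.toTensor_coe π]⟩
  obtain ⟨L, hL⟩ := Ψ.exists_leftInverse_of_injective (LinearMap.ker_eq_bot.2 hinj)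
  let F : D →ₗ[K] LinearMap.ker ε := L ∘ₗ hD.lift f
  have hF : Ψ ∘ₗ F = hD.lift f := by
    ext1 d
    obtain ⟨c, hc⟩ := hrange d
    have := LinearMap.congr_fun hL c
    rw [LinearMap.comp_apply, LinearMap.id_apply] at this
    rw [LinearMap.comp_apply, LinearMap.comp_apply, ← hc, this]
  have hinj2 : Function.Injective (TensorProduct.map Ψ Ψ) := by
    refine Function.LeftInverse.injective (g := TensorProduct.map L L) fun z => ?_
    rw [← LinearMap.comp_apply, ← TensorProduct.map_comp, hL, TensorProduct.map_id,
      LinearMap.id_apply]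
  refine ⟨F, ⟨?_, ?_⟩, ?_⟩
  · refine LinearMap.ext fun d => hinj2 ?_
    have h1 := deconcat_lift π H.conilpotent (F d)
    have h2 := deconcat_lift f hD d
    rw [← hF, LinearMap.comp_apply, ← hΨ.symm] at h2
    rw [← hΨ, h2, add_right_inj] at h1
    rw [LinearMap.comp_apply, ← h1, TensorProduct.map_comp]
    rfl
  · rw [LinearMap.comp_assoc, hF]
    exact LinearMap.ext fun d => degreeOne_lift f hD d
  · rintro G ⟨hG1, hG2⟩
    have hπΨ : degreeOne K (prim e Δ) ∘ₗ Ψ = π :=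
      LinearMap.ext fun c => degreeOne_lift π H.conilpotent c
    rw [hπΨ] at hG2
    have hG : Ψ ∘ₗ G = hD.lift f := by
      refine lift_unique f hD _ fun d => ?_
      rw [LinearMap.comp_apply, hΨ, lift_apply, ← hΨ, ← hG2, LinearMap.comp_apply,
        ← LinearMap.comp_assoc, TensorProduct.map_comp]
      have := LinearMap.congr_fun hG1 d
      rw [LinearMap.comp_apply] at this
      rw [this]
      rfl
    refine LinearMap.ext fun d => hinj ?_
    rw [← LinearMap.comp_apply, ← LinearMap.comp_apply, hG, hF]

omit hπ π in
theorem isCofreeOnPrimitives [CharZero K] : IsCofreeOnPrimitives.{u, v, w} e ε he Δ := by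
  -- Any linear retraction onto the primitives will do; `Φ` depends on this choice.
  obtain ⟨r, hr⟩ := (prim e Δ).subtype.exists_leftInverse_of_injective
    (LinearMap.ker_eq_bot.2 (prim e Δ).subtype_injective)
  let π : LinearMap.ker ε →ₗ[K] prim e Δ := r ∘ₗ (LinearMap.ker ε).subtype
  have hπ : ∀ (x : prim e Δ) (hx : (x : A) ∈ LinearMap.ker ε), π ⟨x, hx⟩ = x :=
    fun x _ => LinearMap.congr_fun hr x
  exact ⟨H.coassoc, H.cocomm, H.counit_left, H.counit_right, H.comul_one, H.conilpotent,
    H.toTensor π, H.toTensor_injective π hπ, H.range_toTensor π hπ,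
    LinearMap.ext (H.deconcat_toTensor π), LinearMap.ext (H.algebraMapInv_toTensor π),
    H.toTensor_one π, H.toTensor_prim π hπ, H.hasCofreeProperty π hπ⟩

end IsMagmaticBialgebra
end Bialgebra

/-! ### Componentwise operations on tensor products. -/

section TensorOperations

variable {K : Type w} [Field K] {A B C D M : Type*} [AddCommGroup A] [Module K A]
  [AddCommGroup B] [Module K B] [AddCommGroup C] [Module K C] [AddCommGroup D] [Module K D]
  [AddCommGroup M] [Module K M] {k : ℕ}

theorem multilinear_ext_tmul {F G : MultilinearMap K (fun _ : Fin k => A ⊗[K] B) M}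
    (h : ∀ (a : Fin k → A) (b : Fin k → B), F (fun i => a i ⊗ₜ b i) = G (fun i => a i ⊗ₜ b i)) : F = G :=
  Module.Basis.ext_multilinear (fun _ => (Module.Basis.ofVectorSpace K A).tensorProduct
    (Module.Basis.ofVectorSpace K B)) fun v => by
      simpa only [Module.Basis.tensorProduct_apply'] using h _ _

/-- The componentwise operation on a tensor product. -/
def tensorOp (f : MultilinearMap K (fun _ : Fin k => A) A)
    (g : MultilinearMap K (fun _ : Fin k => B) B) :
    MultilinearMap K (fun _ : Fin k => A ⊗[K] B) (A ⊗[K] B) :=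
  ((Basis.piTensorProduct (fun _ : Fin k => (Module.Basis.ofVectorSpace K A).tensorProduct
    (Module.Basis.ofVectorSpace K B))).constr K fun T =>
      f (fun i => Module.Basis.ofVectorSpace K A (T i).1) ⊗ₜ[K]
        g (fun i => Module.Basis.ofVectorSpace K B (T i).2)).compMultilinearMap
      (PiTensorProduct.tprod K)

theorem tensorOp_tmul (f : MultilinearMap K (fun _ : Fin k => A) A)
    (g : MultilinearMap K (fun _ : Fin k => B) B) (a : Fin k → A) (b : Fin k → B) :
    tensorOp f g (fun i => a i ⊗ₜ[K] b i) = f a ⊗ₜ[K] g b := by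
  let bA := Module.Basis.ofVectorSpace K A
  let bB := Module.Basis.ofVectorSpace K B
  have h1 : ∀ (S : Fin k → _) (T : Fin k → _), tensorOp f g (fun i => bA (S i) ⊗ₜ[K] bB (T i)) =
      f (fun i => bA (S i)) ⊗ₜ[K] g (fun i => bB (T i)) := by
    intro S T
    have h := (Basis.piTensorProduct (fun _ : Fin k => bA.tensorProduct bB)).constr_basis K
      (fun T => f (fun i => bA (T i).1) ⊗ₜ[K] g (fun i => bB (T i).2)) (fun i => (S i, T i))
    rw [Basis.piTensorProduct_apply] at h
    simp only [Module.Basis.tensorProduct_apply] at h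
    exact h
  have h2 : ∀ S : Fin k → _, ∀ b : Fin k → B, tensorOp f g (fun i => bA (S i) ⊗ₜ[K] b i) =
      f (fun i => bA (S i)) ⊗ₜ[K] g b := by
    intro S b
    have h : (tensorOp f g).compLinearMap (fun i => TensorProduct.mk K _ _ (bA (S i))) =
        (TensorProduct.mk K _ _ (f (fun i => bA (S i)))).compMultilinearMap g :=
      Module.Basis.ext_multilinear (fun _ => bB) (fun T => h1 S T)
    exact congrArg (fun g => g b) h
  have h : (tensorOp f g).compLinearMap (fun i => (TensorProduct.mk K _ _).flip (b i)) =
      ((TensorProduct.mk K _ _).flip (g b)).compMultilinearMap f :=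
    Module.Basis.ext_multilinear (fun _ => bA) (fun S => h2 S b)
  exact congrArg (fun g => g a) h

variable {f : MultilinearMap K (fun _ : Fin k => A) A}
  {g : MultilinearMap K (fun _ : Fin k => B) B} {h : MultilinearMap K (fun _ : Fin k => C) C}
  {p : MultilinearMap K (fun _ : Fin k => D) D}

theorem map_tensorOp (L : A →ₗ[K] B) (N : C →ₗ[K] D)
    (hL : ∀ a, L (f a) = g fun i => L (a i)) (hN : ∀ a, N (h a) = p fun i => N (a i))
    (z : Fin k → A ⊗[K] C) :
    TensorProduct.map L N (tensorOp f h z) =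
      tensorOp g p fun i => TensorProduct.map L N (z i) := by
  have : (TensorProduct.map L N).compMultilinearMap (tensorOp f h) =
      (tensorOp g p).compLinearMap fun _ => TensorProduct.map L N :=
    multilinear_ext_tmul fun a b => by
      simp only [LinearMap.compMultilinearMap_apply, MultilinearMap.compLinearMap_apply,
        tensorOp_tmul, TensorProduct.map_tmul, hL, hN]
  exact congrArg (fun g => g z) this

theorem comm_tensorOp (z : Fin k → A ⊗[K] B) :
    TensorProduct.comm K A B (tensorOp f g z) =
      tensorOp g f fun i => TensorProduct.comm K A B (z i) := by
  have : (TensorProduct.comm K A B).toLinearMap.compMultilinearMap (tensorOp f g) =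
      (tensorOp g f).compLinearMap fun _ => (TensorProduct.comm K A B).toLinearMap :=
    multilinear_ext_tmul fun a b => by
      simp only [LinearMap.compMultilinearMap_apply, MultilinearMap.compLinearMap_apply,
        tensorOp_tmul, LinearEquiv.coe_coe, TensorProduct.comm_tmul]
  exact congrArg (fun g => g z) this

theorem assoc_tensorOp (z : Fin k → (A ⊗[K] B) ⊗[K] C) :
    TensorProduct.assoc K A B C (tensorOp (tensorOp f g) h z) =
      tensorOp f (tensorOp g h) fun i => TensorProduct.assoc K A B C (z i) := by
  let F := (TensorProduct.assoc K A B C).toLinearMap.compMultilinearMap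
    (tensorOp (tensorOp f g) h)
  let G := (tensorOp f (tensorOp g h)).compLinearMap
    fun _ => (TensorProduct.assoc K A B C).toLinearMap
  have : F = G := by
    refine multilinear_ext_tmul fun a c => ?_
    have h1 : F.compLinearMap (fun i => (TensorProduct.mk K _ _).flip (c i)) =
        G.compLinearMap (fun i => (TensorProduct.mk K _ _).flip (c i)) :=
      multilinear_ext_tmul fun a b => by
        simp only [F, G, LinearMap.compMultilinearMap_apply, MultilinearMap.compLinearMap_apply,
          LinearMap.flip_apply, TensorProduct.mk_apply, tensorOp_tmul, LinearEquiv.coe_coe,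
          TensorProduct.assoc_tmul]
    exact congrArg (fun g => g a) h1
  exact congrArg (fun g => g z) this

/-- Entries are relaxed from `S i` to its span one at a time: with the others fixed, membership in
`N` is a linear condition on the remaining entry. -/
theorem multilinear_mem_of_mem_span {E P : Type*} [AddCommGroup E] [Module K E] [AddCommGroup P]
    [Module K P] (F : MultilinearMap K (fun _ : Fin k => E) P) (S : Fin k → Set E)
    (N : Submodule K P) (hF : ∀ z, (∀ i, z i ∈ S i) → F z ∈ N) (z : Fin k → E)
    (hz : ∀ i, z i ∈ Submodule.span K (S i)) : F z ∈ N := by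
  suffices key : ∀ s : Finset (Fin k), ∀ z : Fin k → E,
      (∀ i ∈ s, z i ∈ Submodule.span K (S i)) → (∀ i ∉ s, z i ∈ S i) → F z ∈ N from
    key Finset.univ z (fun i _ => hz i) (fun i hi => absurd (Finset.mem_univ i) hi)
  intro s
  induction s using Finset.induction_on with
  | empty => exact fun z _ h => hF z fun i => h i (Finset.notMem_empty i)
  | insert j s hj ih =>
    intro z h1 h2
    have h3 : Submodule.span K (S j) ≤ N.comap (F.toLinearMap z j) := by
      refine Submodule.span_le.2 fun x hx => ?_
      refine ih _ (fun i hi => ?_) fun i hi => ?_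
      · rw [Function.update_of_ne (ne_of_mem_of_not_mem hi hj)]
        exact h1 i (Finset.mem_insert_of_mem hi)
      · by_cases hij : i = j
        · subst hij; simpa using hx
        · rw [Function.update_of_ne hij]
          exact h2 i (by simp [hij, hi])
    have := h3 (h1 j (Finset.mem_insert_self j s))
    simpa using this

end TensorOperations

/-! ### Algebras generated by primitive elements. -/

section Generated

variable {K : Type w} [Field K] {A : Type u} [AddCommGroup A] [Module K A] {J : Type*}
  {k : J → ℕ} (f : ∀ j, MultilinearMap K (fun _ : Fin (k j) => A) A) (G : Set A) (e : A)

/-- The monomials of a given degree in a set of generators, for a family of operations. -/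
inductive IsMonomial : ℕ → A → Prop
  | one : IsMonomial 0 e
  | gen (x : A) : x ∈ G → IsMonomial 1 x
  | op (j : J) (n : Fin (k j) → ℕ) (a : Fin (k j) → A) :
      (∀ i, IsMonomial (n i) (a i)) → IsMonomial (∑ i, n i) (f j a)

/-- A unital algebra for a family of operations, generated by primitive elements. -/
structure IsPrimitivelyGenerated (ε : A →ₗ[K] K) (Δ : A →ₗ[K] A ⊗[K] A) : Prop where
  span_eq_top : ∀ a, a ∈ Submodule.span K {a | ∃ n, IsMonomial f G e n a}
  counit_one : ε e = 1
  comul_one : Δ e = e ⊗ₜ[K] e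
  counit_gen : ∀ x ∈ G, ε x = 0
  comul_gen : ∀ x ∈ G, Δ x = x ⊗ₜ[K] e + e ⊗ₜ[K] x
  op_one : ∀ j, f j (fun _ => e) = e
  counit_op : ∀ j a, ε (f j a) = ∏ i, ε (a i)
  comul_op : ∀ j a, Δ (f j a) = tensorOp (f j) (f j) fun i => Δ (a i)

variable {f G e} {ε : A →ₗ[K] K} {Δ : A →ₗ[K] A ⊗[K] A}

namespace IsPrimitivelyGenerated

variable (H : IsPrimitivelyGenerated f G e ε Δ)

include H

theorem ext {M : Type*} [AddCommGroup M] [Module K M] {L N : A →ₗ[K] M}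
    (h : ∀ n a, IsMonomial f G e n a → L a = N a) : L = N := by
  refine LinearMap.ext fun a => ?_
  have h1 : Submodule.span K {a | ∃ n, IsMonomial f G e n a} ≤ LinearMap.eqLocus L N :=
    Submodule.span_le.2 fun a ⟨n, ha⟩ => h n a ha
  exact h1 (H.span_eq_top a)

/-- Both composites respect the operations, since `assoc` identifies the two componentwise
structures on the triple tensor product. It remains to compare them on the unit and the generators.
-/
theorem coassoc : IsCoassociative Δ := by
  refine H.ext fun n a ha => ?_
  induction ha with
  | one => simp [H.comul_one]
  | gen x hx =>
    simp only [LinearMap.comp_apply, LinearEquiv.coe_coe, H.comul_gen x hx, map_add,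
      LinearMap.rTensor_tmul, LinearMap.lTensor_tmul, H.comul_one, TensorProduct.assoc_tmul,
      TensorProduct.add_tmul, TensorProduct.tmul_add]
    abel
  | op j n a _ ih =>
    simp only [LinearMap.comp_apply, LinearEquiv.coe_coe] at ih ⊢
    rw [H.comul_op, LinearMap.rTensor, LinearMap.lTensor,
      map_tensorOp (g := tensorOp (f j) (f j)) (p := f j) _ _ (H.comul_op j) (fun _ => rfl),
      map_tensorOp (g := f j) (p := tensorOp (f j) (f j)) _ _ (fun _ => rfl) (H.comul_op j),
      assoc_tensorOp]
    exact congrArg _ (funext ih)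

theorem cocomm : IsCocommutative Δ := by
  refine H.ext fun n a ha => ?_
  induction ha with
  | one => simp [H.comul_one]
  | gen x hx => simp [H.comul_gen x hx, add_comm]
  | op j n a _ ih =>
    simp only [LinearMap.comp_apply, LinearEquiv.coe_coe] at ih ⊢
    rw [H.comul_op, comm_tensorOp]
    exact congrArg _ (funext ih)

theorem counit_left :
    (TensorProduct.lid K A).toLinearMap ∘ₗ ε.rTensor A ∘ₗ Δ = LinearMap.id := by
  refine H.ext fun n a ha => ?_
  induction ha with
  | one => simp [H.comul_one, H.counit_one]
  | gen x hx => simp [H.comul_gen x hx, H.counit_gen x hx, H.counit_one]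
  | op j n a _ ih =>
    simp only [LinearMap.comp_apply, LinearEquiv.coe_coe, LinearMap.id_apply] at ih ⊢
    have : ((TensorProduct.lid K A).toLinearMap ∘ₗ ε.rTensor A).compMultilinearMap
        (tensorOp (f j) (f j)) = (f j).compLinearMap
          fun _ => (TensorProduct.lid K A).toLinearMap ∘ₗ ε.rTensor A :=
      multilinear_ext_tmul fun a b => by
        simp only [LinearMap.compMultilinearMap_apply, MultilinearMap.compLinearMap_apply,
          tensorOp_tmul, LinearMap.comp_apply, LinearEquiv.coe_coe, LinearMap.rTensor_tmul,
          TensorProduct.lid_tmul, H.counit_op, MultilinearMap.map_smul_univ]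
    rw [H.comul_op]
    refine (congrArg (fun g => g fun i => Δ (a i)) this).trans ?_
    exact congrArg _ (funext ih)

theorem counit_right :
    (TensorProduct.rid K A).toLinearMap ∘ₗ ε.lTensor A ∘ₗ Δ = LinearMap.id := by
  conv_rhs => rw [← H.counit_left]
  refine LinearMap.ext fun a => ?_
  conv_rhs => rw [← H.cocomm]
  simp only [LinearMap.comp_apply]
  generalize Δ a = z
  induction z with
  | zero => simp
  | add x y hx hy => simp only [map_add, hx, hy]
  | tmul x y => simp

omit H in
theorem eq_one_of_degree_zero (h1 : ∀ j, f j (fun _ => e) = e) {n : ℕ} {a : A}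
    (ha : IsMonomial f G e n a) (hn : n = 0) : a = e := by
  induction ha with
  | one => rfl
  | gen x hx => exact absurd hn one_ne_zero
  | op j n a _ ih =>
    have h0 : ∀ i, n i = 0 := by simpa using hn
    rw [funext fun i => ih i (h0 i), h1]

/-- The co-addition preserves total degree, as generators do and the operations add degrees in each
tensor factor. -/
theorem comul_mem_span {n : ℕ} {a : A} (ha : IsMonomial f G e n a) :
    Δ a ∈ Submodule.span K {z | ∃ i j x y, i + j = n ∧ IsMonomial f G e i x ∧
      IsMonomial f G e j y ∧ x ⊗ₜ[K] y = z} := by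
  induction ha with
  | one =>
    rw [H.comul_one]
    exact Submodule.subset_span ⟨0, 0, e, e, rfl, .one, .one, rfl⟩
  | gen x hx =>
    rw [H.comul_gen x hx]
    exact add_mem (Submodule.subset_span ⟨1, 0, x, e, rfl, .gen x hx, .one, rfl⟩)
      (Submodule.subset_span ⟨0, 1, e, x, rfl, .one, .gen x hx, rfl⟩)
  | op j n a _ ih =>
    rw [H.comul_op]
    refine multilinear_mem_of_mem_span _ _ _ (fun z hz => ?_) _ ih
    choose i i' x y hn hx hy hz using hz
    refine Submodule.subset_span ⟨∑ l, i l, ∑ l, i' l, f j x, f j y, ?_, .op j i x hx,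
      .op j i' y hy, ?_⟩
    · rw [← Finset.sum_add_distrib]
      exact Finset.sum_congr rfl fun l _ => hn l
    · rw [← tensorOp_tmul, funext hz]

theorem iterComul_augProj_eq_zero (m n : ℕ) (a : A) (ha : IsMonomial f G e n a) (hn : n ≤ m) :
    iterComul (reducedComul e ε H.counit_one Δ) m (augProj e ε H.counit_one a) = 0 := by
  induction m generalizing n a with
  | zero =>
    rw [eq_one_of_degree_zero H.op_one ha (Nat.le_zero.1 hn), augProj_one, map_zero]
  | succ m ih =>
    simp only [iterComul, LinearMap.comp_apply]
    rw [reducedComul_augProj H.comul_one, ← LinearMap.comp_apply (TensorProduct.map _ _),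
      ← TensorProduct.map_comp]
    have h1 : Submodule.span K {z | ∃ i j x y, i + j = n ∧ IsMonomial f G e i x ∧
        IsMonomial f G e j y ∧ x ⊗ₜ[K] y = z} ≤ LinearMap.ker (TensorProduct.map
          (iterComul (reducedComul e ε H.counit_one Δ) m ∘ₗ augProj e ε H.counit_one)
          (TensorAlgebra.ι K ∘ₗ augProj e ε H.counit_one)) := by
      refine Submodule.span_le.2 ?_
      rintro _ ⟨i, j, x, y, hij, hx, hy, rfl⟩
      rw [SetLike.mem_coe, LinearMap.mem_ker, TensorProduct.map_tmul, LinearMap.comp_apply,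
        LinearMap.comp_apply]
      -- A right factor of degree zero is the unit, which the projection kills; otherwise the left
      -- factor has degree at most `m`.
      rcases Nat.eq_zero_or_pos j with hj | hj
      · rw [eq_one_of_degree_zero H.op_one hy hj, augProj_one, map_zero, TensorProduct.tmul_zero]
      · rw [ih i x hx (by omega), TensorProduct.zero_tmul]
    rw [LinearMap.mem_ker.1 (h1 (H.comul_mem_span ha)), map_zero]

theorem conilpotent : IsConilpotentComCoalgebra (reducedComul e ε H.counit_one Δ) := by
  set p := augProj e ε H.counit_one with hp
  have hδ : reducedComul e ε H.counit_one Δ ∘ₗ p = TensorProduct.map p p ∘ₗ Δ :=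
    LinearMap.ext (reducedComul_augProj H.comul_one)
  refine ⟨?_, ?_, fun c => ?_⟩
  · refine LinearMap.ext fun c => ?_
    have h1 := LinearMap.congr_fun H.coassoc c
    simp only [LinearMap.comp_apply, LinearEquiv.coe_coe] at h1 ⊢
    rw [← augProj_coe (he := H.counit_one) c, reducedComul_augProj H.comul_one, ← hp,
      LinearMap.rTensor, LinearMap.lTensor, ← LinearMap.comp_apply (TensorProduct.map _ _),
      ← TensorProduct.map_comp, hδ, ← LinearMap.comp_apply (TensorProduct.map _ _) _ (Δ _),
      ← TensorProduct.map_comp, hδ, LinearMap.id_comp]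
    have h2 : ∀ z, TensorProduct.assoc K _ _ _ (TensorProduct.map (TensorProduct.map p p ∘ₗ Δ) p z) =
        TensorProduct.map p (TensorProduct.map p p)
          (TensorProduct.assoc K _ _ _ (Δ.rTensor A z)) := by
      intro z
      rw [← LinearEquiv.coe_coe, ← LinearEquiv.coe_coe, ← LinearMap.comp_apply (TensorProduct.map _ _),
        TensorProduct.map_map_comp_assoc_eq, LinearMap.comp_apply, LinearMap.rTensor,
        ← LinearMap.comp_apply (TensorProduct.map _ _) (TensorProduct.map _ _),
        ← TensorProduct.map_comp, LinearMap.comp_id]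
    rw [h2, h1, LinearMap.lTensor, ← LinearMap.comp_apply (TensorProduct.map _ _),
      ← TensorProduct.map_comp, LinearMap.comp_id]
  · refine LinearMap.ext fun c => ?_
    rw [LinearMap.comp_apply, LinearEquiv.coe_coe, ← augProj_coe (he := H.counit_one) c,
      reducedComul_augProj H.comul_one, map_comul_comm H.cocomm]
  -- The elements killed by all `δⁿ` with `n ≥ m` form an increasing chain of subspaces. Its union
  -- is a subspace containing every monomial, hence everything.
  · have h1 : Submodule.span K {a | ∃ n, IsMonomial f G e n a} ≤
        ⨆ m : ℕ, ⨅ n : Set.Ici m, LinearMap.ker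
          (iterComul (reducedComul e ε H.counit_one Δ) (n : ℕ) ∘ₗ p) := by
      refine Submodule.span_le.2 ?_
      rintro a ⟨m, ha⟩
      refine Submodule.mem_iSup_of_mem m ((Submodule.mem_iInf _).2 fun n => ?_)
      exact H.iterComul_augProj_eq_zero n m a ha n.2
    have hmono : Monotone fun m : ℕ => ⨅ n : Set.Ici m, LinearMap.ker
        (iterComul (reducedComul e ε H.counit_one Δ) (n : ℕ) ∘ₗ p) := fun m m' hm =>
      le_iInf fun n => iInf_le (fun n : Set.Ici m => LinearMap.ker
        (iterComul (reducedComul e ε H.counit_one Δ) (n : ℕ) ∘ₗ p)) ⟨n, hm.trans n.2⟩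
    obtain ⟨N, hN⟩ := (Submodule.mem_iSup_of_directed _ hmono.directed_le).1
      (h1 (H.span_eq_top c))
    refine ⟨N, fun n hn => ?_⟩
    have := (Submodule.mem_iInf _).1 hN ⟨n, hn.le⟩
    rw [LinearMap.mem_ker, LinearMap.comp_apply, hp, augProj_coe] at this
    exact this

theorem isMagmaticBialgebra (he : ε e = 1) {μ : A →ₗ[K] A →ₗ[K] A} (one_mul : ∀ a, μ e a = a)
    (mul_one : ∀ a, μ a e = a) (counit_mul : ∀ a b, ε (μ a b) = ε a * ε b)
    (comul_mul : ∀ a b, Δ (μ a b) = TensorProduct.map₂ μ μ (Δ a) (Δ b)) :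
    IsMagmaticBialgebra e ε he Δ μ :=
  ⟨H.coassoc, H.cocomm, H.counit_left, H.counit_right, H.comul_one, H.conilpotent, one_mul,
    mul_one, counit_mul, comul_mul⟩

end IsPrimitivelyGenerated
end Generated

/-! ### Passing to a binary operation, and inserting units. -/

section Binary

theorem update_vec_zero {A : Type*} (a b x : A) : Function.update ![a, b] 0 x = ![x, b] := by
  ext i; fin_cases i <;> rfl

theorem update_vec_one {A : Type*} (a b x : A) : Function.update ![a, b] 1 x = ![a, x] := by
  ext i; fin_cases i <;> rfl

variable {K : Type w} [Field K] {A : Type u} [AddCommGroup A] [Module K A]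

/-- The bilinear map given by a binary operation. -/
def binaryOp (f : MultilinearMap K (fun _ : Fin 2 => A) A) : A →ₗ[K] A →ₗ[K] A :=
  LinearMap.mk₂ K (fun a b => f ![a, b])
    (fun a a' b => by simpa only [update_vec_zero] using f.map_update_add ![0, b] 0 a a')
    (fun c a b => by simpa only [update_vec_zero] using f.map_update_smul ![0, b] 0 c a)
    (fun a b b' => by simpa only [update_vec_one] using f.map_update_add ![a, 0] 1 b b')
    (fun c a b => by simpa only [update_vec_one] using f.map_update_smul ![a, 0] 1 c b)

theorem binaryOp_apply (f : MultilinearMap K (fun _ : Fin 2 => A) A) (a b : A) :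
    binaryOp f a b = f ![a, b] := rfl

theorem map₂_binaryOp (f : MultilinearMap K (fun _ : Fin 2 => A) A) (y z : A ⊗[K] A) :
    TensorProduct.map₂ (binaryOp f) (binaryOp f) y z = tensorOp f f ![y, z] := by
  rw [← binaryOp_apply (tensorOp f f)]
  induction y with
  | zero => simp
  | add y y' hy hy' => rw [map_add, LinearMap.add_apply, hy, hy', map_add, LinearMap.add_apply]
  | tmul a b =>
    induction z with
    | zero => simp
    | add z z' hz hz' => rw [map_add, hz, hz', map_add]
    | tmul c d =>
      have h : ![a ⊗ₜ[K] b, c ⊗ₜ[K] d] = fun i => ![a, c] i ⊗ₜ[K] ![b, d] i := by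
        ext i; fin_cases i <;> rfl
      rw [binaryOp_apply, h, tensorOp_tmul, TensorProduct.map₂_apply_tmul,
        TensorProduct.map_tmul, binaryOp_apply, binaryOp_apply]

variable {J : Type*} {k : J → ℕ} {f : ∀ j, MultilinearMap K (fun _ : Fin (k j) => A) A}
  {G : Set A} {e : A} {ε : A →ₗ[K] K} {Δ : A →ₗ[K] A ⊗[K] A}

theorem IsPrimitivelyGenerated.isCofreeOnPrimitives [CharZero K]
    (H : IsPrimitivelyGenerated f G e ε Δ) (he : ε e = 1)
    (m : MultilinearMap K (fun _ : Fin 2 => A) A) (one_mul : ∀ a, m ![e, a] = a)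
    (mul_one : ∀ a, m ![a, e] = a) (counit_mul : ∀ a, ε (m a) = ∏ i, ε (a i))
    (comul_mul : ∀ a, Δ (m a) = tensorOp m m fun i => Δ (a i)) :
    IsCofreeOnPrimitives.{u, v, w} e ε he Δ :=
  (H.isMagmaticBialgebra he (μ := binaryOp m) one_mul mul_one
    (fun a b => by rw [binaryOp_apply, counit_mul, Fin.prod_univ_two]; rfl)
    (fun a b => by
      rw [binaryOp_apply, comul_mul, map₂_binaryOp]
      congr 1
      ext i; fin_cases i <;> rfl)).isCofreeOnPrimitives

/-- Deletion of units carries over from `A` to `A ⊗ A`; this allows empty trees to be dropped on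
both sides of the morphism identity for the co-addition. -/
theorem tensorOp_insertNth {n : ℕ} {p : Fin (n + 1)}
    {m' : MultilinearMap K (fun _ : Fin (n + 1) => A) A}
    {m : MultilinearMap K (fun _ : Fin n => A) A}
    (h : ∀ a : Fin n → A, m' (p.insertNth e a) = m a) (z : Fin n → A ⊗[K] A) :
    tensorOp m' m' (p.insertNth (e ⊗ₜ[K] e) z) = tensorOp m m z := by
  have : (tensorOp m' m').curryMid p (e ⊗ₜ[K] e) = tensorOp m m :=
    multilinear_ext_tmul fun a b => by
      have hab : p.insertNth (α := fun _ => A ⊗[K] A) (e ⊗ₜ[K] e) (fun i => a i ⊗ₜ[K] b i) =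
          fun i => p.insertNth (α := fun _ => A) e a i ⊗ₜ[K]
            p.insertNth (α := fun _ => A) e b i := by
        ext i; cases i using Fin.succAboveCases p <;> simp
      rw [MultilinearMap.curryMid_apply_apply, hab, tensorOp_tmul, tensorOp_tmul, h, h]
  exact congrArg (fun g => g z) this

end Binary

/-! ### The algebra of reduced planar trees. -/

section MagOmega

variable {X : Type u} {K : Type w} [Field K]

theorem reduceOption_ofFn_insertNth {α : Type*} {n : ℕ} (p : Fin (n + 1)) (T : Fin n → Option α) :
    (List.ofFn (p.insertNth (α := fun _ => Option α) none T)).reduceOption =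
      (List.ofFn T).reduceOption := by
  induction n with
  | zero =>
    obtain rfl := Fin.fin_one_eq_zero p
    simp [List.ofFn_succ]
  | succ n ih =>
    cases p using Fin.cases with
    | zero => rw [List.ofFn_succ]; simp
    | succ p =>
      rw [List.ofFn_succ, List.ofFn_succ (f := T)]
      have h0 : p.succ.insertNth (α := fun _ => Option α) none T 0 = T 0 := by
        have := Fin.insertNth_apply_succAbove (α := fun _ => Option α) p.succ none T 0
        rwa [Fin.succ_succAbove_zero] at this
      have h1 : (fun i : Fin (n + 1) => p.succ.insertNth (α := fun _ => Option α) none T i.succ) =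
          p.insertNth (α := fun _ => Option α) none (fun i => T i.succ) := by
        ext1 i
        cases i using Fin.succAboveCases p with
        | x => simp
        | p i =>
          rw [Fin.insertNth_apply_succAbove, ← Fin.succ_succAbove_succ,
            Fin.insertNth_apply_succAbove]
      rw [h0, h1]
      cases T 0 with
      | none => rw [List.reduceOption_cons_of_none, List.reduceOption_cons_of_none, ih]
      | some _ => rw [List.reduceOption_cons_of_some, List.reduceOption_cons_of_some, ih]

theorem graft_ofFn_insertNth {n : ℕ} (p : Fin (n + 1)) (T : Fin n → Option (PRTree X)) :
    graft (List.ofFn (p.insertNth (α := fun _ => Option (PRTree X)) none T)) =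
      graft (List.ofFn T) := by
  simp only [graft, reduceOption_ofFn_insertNth]

theorem reduceOption_map_some {α : Type*} (l : List α) : (l.map some).reduceOption = l := by
  induction l with
  | nil => rfl
  | cons a l ih => simp [ih]

theorem graft_ofFn_some {n : ℕ} (t : Fin (n + 2) → PRTree X) :
    graft (List.ofFn fun i => some (t i)) = some (PRTree.node n t) := by
  have h1 : (List.ofFn fun i => some (t i)) = (List.ofFn t).map some := by
    rw [List.map_ofFn]; rfl
  have key : ∀ (l : List (PRTree X)) (hl : l.length = n + 2),
      graft (l.map some) = some (PRTree.node n fun i => l.get (i.cast hl.symm)) := by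
    intro l hl
    match l with
    | [] => simp at hl
    | [_] => simp at hl
    | t :: s :: r =>
      obtain rfl : r.length = n := by simpa using hl
      simp only [graft, reduceOption_map_some]
      rfl
  rw [h1, key _ (List.length_ofFn)]
  congr 2
  ext i
  simp only [List.get_eq_getElem, Fin.val_cast, List.getElem_ofFn]

theorem vee_insertNth {n : ℕ} (p : Fin (n + 1)) (a : Fin n → MagOmegaAlg X K) :
    vee X K (n + 1) (p.insertNth (Finsupp.single none 1) a) = vee X K n a := by
  have : (vee X K (n + 1)).curryMid p (Finsupp.single none 1) = vee X K n := by
    refine Module.Basis.ext_multilinear (fun _ => monomialBasis X K) fun T => ?_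
    have hT : p.insertNth (α := fun _ => MagOmegaAlg X K) (Finsupp.single none 1)
        (fun i => Finsupp.single (T i) 1) = fun i => Finsupp.single
          (p.insertNth (α := fun _ => Option (PRTree X)) none T i) 1 := by
      ext1 i; cases i using Fin.succAboveCases p <;> simp
    simp only [MultilinearMap.curryMid_apply_apply, Finsupp.coe_basisSingleOne]
    rw [hT, vee_monomial, vee_monomial, graft_ofFn_insertNth]
  exact congrArg (fun g => g a) this

theorem graft_singleton (T : Option (PRTree X)) : graft [T] = T := by
  cases T <;> rfl

theorem vee_one (a : Fin 1 → MagOmegaAlg X K) : vee X K 1 a = a 0 := by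
  have : vee X K 1 = MultilinearMap.ofSubsingleton K _ _ (0 : Fin 1) LinearMap.id := by
    refine Module.Basis.ext_multilinear (fun _ => monomialBasis X K) fun T => ?_
    simp only [Finsupp.coe_basisSingleOne]
    rw [vee_monomial]
    simp [graft_singleton]
  rw [this]
  rfl

theorem tensorOp_vee (n : ℕ) : tensorOp (vee X K n) (vee X K n) = veeTensor X K n := by
  refine multilinear_ext_tmul (K := K) (A := MagOmegaAlg X K) (B := MagOmegaAlg X K)
    (M := MagOmegaAlg X K ⊗[K] MagOmegaAlg X K) fun a b => ?_
  rw [tensorOp_tmul, veeTensor_tmul]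

theorem coaddInf_single_some (t : PRTree X) :
    coaddInf X K (Finsupp.single (some t) 1) = coaddTree K t := by
  have := (monomialBasis X K).constr_basis K (fun T =>
    match T with
    | none => Finsupp.single none 1 ⊗ₜ[K] Finsupp.single none 1
    | some t => coaddTree K t) (some t)
  rw [Finsupp.coe_basisSingleOne] at this
  exact this

theorem coaddInf_one : coaddInf X K (Finsupp.single none 1) =
    Finsupp.single none 1 ⊗ₜ[K] Finsupp.single none 1 := by
  have := (monomialBasis X K).constr_basis K (fun T =>
    match T with
    | none => Finsupp.single none 1 ⊗ₜ[K] Finsupp.single none 1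
    | some t => coaddTree K t) none
  rw [Finsupp.coe_basisSingleOne] at this
  exact this

/-- The defining recursion covers only nonempty trees in arity at least two. Empty arguments are
deleted one by one, lowering the arity; with none left, arity zero gives the unit, arity one the
identity, and higher arity the recursion itself. -/
theorem coaddInf_vee_monomial {n : ℕ} (T : Fin n → Option (PRTree X)) :
    coaddInf X K (vee X K n fun i => Finsupp.single (T i) 1) =
      tensorOp (vee X K n) (vee X K n) fun i => coaddInf X K (Finsupp.single (T i) 1) := by
  induction n with
  | zero =>
    have h : (fun i => coaddInf X K (Finsupp.single (T i) 1)) = fun i : Fin 0 =>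
        (Finsupp.single (T i) 1 : MagOmegaAlg X K) ⊗ₜ[K] Finsupp.single (T i) 1 :=
      funext fun i => i.elim0
    rw [h, tensorOp_tmul, vee_monomial]
    simp only [List.ofFn_zero]
    exact coaddInf_one
  | succ n ih =>
    by_cases hp : ∃ p, T p = none
    · obtain ⟨p, hp⟩ := hp
      obtain ⟨S, rfl⟩ : ∃ S, T = p.insertNth (α := fun _ => Option (PRTree X)) none S :=
        ⟨p.removeNth T, by rw [← hp, Fin.insertNth_self_removeNth]⟩
      have h1 : (fun i => (Finsupp.single (p.insertNth (α := fun _ => Option (PRTree X)) none S i) 1 :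
          MagOmegaAlg X K)) = p.insertNth (α := fun _ => MagOmegaAlg X K) (Finsupp.single none 1)
            (fun i => Finsupp.single (S i) 1) := by
        ext1 i; cases i using Fin.succAboveCases p <;> simp
      have h2 : (fun i => coaddInf X K (Finsupp.single
          (p.insertNth (α := fun _ => Option (PRTree X)) none S i) 1)) =
          p.insertNth (α := fun _ => MagOmegaAlg X K ⊗[K] MagOmegaAlg X K)
            (Finsupp.single none 1 ⊗ₜ[K] Finsupp.single none 1)
            (fun i => coaddInf X K (Finsupp.single (S i) 1)) := by
        ext1 i; cases i using Fin.succAboveCases p <;> simp [coaddInf_one]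
      rw [h1, h2, vee_insertNth, tensorOp_insertNth (vee_insertNth p), ih]
    · push Not at hp
      choose t ht using fun i => Option.ne_none_iff_exists'.1 (hp i)
      obtain rfl : T = fun i => some (t i) := funext ht
      cases n with
      | zero =>
        have h : tensorOp (vee X K 1) (vee X K 1) =
            MultilinearMap.ofSubsingleton K _ _ (0 : Fin 1) LinearMap.id := by
          refine multilinear_ext_tmul (K := K) (A := MagOmegaAlg X K) (B := MagOmegaAlg X K)
            (M := MagOmegaAlg X K ⊗[K] MagOmegaAlg X K) fun a b => ?_
          rw [tensorOp_tmul, vee_one, vee_one]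
          rfl
        rw [vee_one, h]
        rfl
      | succ n =>
        rw [vee_monomial, graft_ofFn_some, tensorOp_vee]
        simp only [coaddInf_single_some]
        rw [coaddTree]

theorem coaddInf_vee {n : ℕ} (a : Fin n → MagOmegaAlg X K) :
    coaddInf X K (vee X K n a) =
      tensorOp (vee X K n) (vee X K n) fun i => coaddInf X K (a i) := by
  have : (coaddInf X K).compMultilinearMap (vee X K n) =
      (tensorOp (vee X K n) (vee X K n)).compLinearMap fun _ => coaddInf X K := by
    refine Module.Basis.ext_multilinear (fun _ => monomialBasis X K) fun T => ?_
    simp only [LinearMap.compMultilinearMap_apply, MultilinearMap.compLinearMap_apply,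
      Finsupp.coe_basisSingleOne]
    exact coaddInf_vee_monomial T
  exact congrArg (fun g => g a) this

theorem graft_ofFn_eq_none_iff {n : ℕ} (T : Fin n → Option (PRTree X)) :
    graft (List.ofFn T) = none ↔ ∀ i, T i = none := by
  have h1 : ∀ l : List (Option (PRTree X)), graft l = none ↔ l.reduceOption = [] := by
    intro l
    simp only [graft]
    split <;> simp_all
  rw [h1, List.reduceOption, List.filterMap_eq_nil_iff]
  simp

theorem counitInf_vee {n : ℕ} (a : Fin n → MagOmegaAlg X K) :
    counitInf X K (vee X K n a) = ∏ i, counitInf X K (a i) := by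
  classical
  have : (counitInf X K).compMultilinearMap (vee X K n) =
      (MultilinearMap.mkPiAlgebra K (Fin n) K).compLinearMap fun _ => counitInf X K := by
    refine Module.Basis.ext_multilinear (fun _ => monomialBasis X K) fun T => ?_
    simp only [LinearMap.compMultilinearMap_apply, MultilinearMap.compLinearMap_apply,
      Finsupp.coe_basisSingleOne, vee_monomial, MultilinearMap.mkPiAlgebra_apply, counitInf,
      Finsupp.lapply_apply, Finsupp.single_apply, graft_ofFn_eq_none_iff]
    rw [Finset.prod_ite_zero]
    simp
  exact congrArg (fun g => g a) this

theorem vee_const_one (n : ℕ) :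
    vee X K n (fun _ => Finsupp.single none 1) = Finsupp.single none 1 := by
  rw [vee_monomial fun _ => none, (graft_ofFn_eq_none_iff _).2 fun _ => rfl]

theorem vee_two_one_left (a : MagOmegaAlg X K) : vee X K 2 ![Finsupp.single none 1, a] = a := by
  have h := vee_insertNth (K := K) (0 : Fin 2) ![a]
  rw [vee_one, Fin.insertNth_zero'] at h
  exact h

theorem vee_two_one_right (a : MagOmegaAlg X K) : vee X K 2 ![a, Finsupp.single none 1] = a := by
  have h := vee_insertNth (K := K) (Fin.last 1) ![a]
  rw [vee_one, Fin.insertNth_last'] at h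
  refine Eq.trans (congrArg _ ?_) h
  ext1 i
  fin_cases i <;> rfl

theorem isPrimitivelyGenerated_magOmega :
    IsPrimitivelyGenerated (fun n => vee X K n)
      (Set.range fun x => Finsupp.single (some (PRTree.leaf x)) (1 : K))
      (Finsupp.single none 1) (counitInf X K) (coaddInf X K) where
  span_eq_top a := by
    have h1 : ∀ t : PRTree X, ∃ n, IsMonomial (fun n => vee X K n)
        (Set.range fun x => Finsupp.single (some (PRTree.leaf x)) (1 : K))
        (Finsupp.single none 1) n (Finsupp.single (some t) 1) := by
      intro t
      induction t with
      | leaf x => exact ⟨1, .gen _ ⟨x, rfl⟩⟩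
      | node n t ih =>
        choose d hd using ih
        refine ⟨∑ i, d i, ?_⟩
        rw [← graft_ofFn_some, ← vee_monomial]
        exact IsMonomial.op (k := fun n => n) (f := fun n => vee X K n) (n + 2) d _ hd
    have h2 : ⊤ ≤ Submodule.span K {a | ∃ n, IsMonomial (fun n => vee X K n)
        (Set.range fun x => Finsupp.single (some (PRTree.leaf x)) (1 : K))
        (Finsupp.single none 1) n a} := by
      rw [← (monomialBasis X K).span_eq]
      refine Submodule.span_mono ?_
      rintro _ ⟨T, rfl⟩
      rw [Finsupp.coe_basisSingleOne]
      cases T with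
      | none => exact ⟨0, .one⟩
      | some t => exact h1 t
    exact h2 Submodule.mem_top
  counit_one := counitInf_one X K
  comul_one := coaddInf_one
  counit_gen := by
    rintro _ ⟨x, rfl⟩
    simp [counitInf]
  comul_gen := by
    rintro _ ⟨x, rfl⟩
    simp only [coaddInf_single_some]
    rw [coaddTree]
  op_one := vee_const_one
  counit_op _ := counitInf_vee
  comul_op _ := coaddInf_vee

end MagOmega

/-! ### The free unitary magma algebra. -/

section Mag

variable {X : Type u} {K : Type w} [Field K]

/-- Multiplication as a binary operation. -/
def mulOp (A : Type*) [NonUnitalNonAssocRing A] [Module K A] [IsScalarTower K A A]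
    [SMulCommClass K A A] : MultilinearMap K (fun _ : Fin 2 => A) A :=
  .mk' (fun a => a 0 * a 1)
    (fun a i x y => by fin_cases i <;> simp [add_mul, mul_add])
    (fun a i c x => by
      fin_cases i
      · simpa using smul_mul_assoc c x (a 1)
      · simpa using mul_smul_comm c (a 0) x)

theorem mulOp_apply (A : Type*) [NonUnitalNonAssocRing A] [Module K A] [IsScalarTower K A A]
    [SMulCommClass K A A] (a : Fin 2 → A) : mulOp (K := K) A a = a 0 * a 1 := rfl

theorem tensorOp_mulOp (z : Fin 2 → MagAlg X K ⊗[K] MagAlg X K) :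
    tensorOp (mulOp (K := K) (MagAlg X K)) (mulOp (MagAlg X K)) z = z 0 * z 1 := by
  have : tensorOp (mulOp (K := K) (MagAlg X K)) (mulOp (MagAlg X K)) =
      mulOp (K := K) (MagAlg X K ⊗[K] MagAlg X K) :=
    multilinear_ext_tmul fun a b => by
      rw [tensorOp_tmul, mulOp_apply, mulOp_apply, mulOp_apply,
        Algebra.TensorProduct.tmul_mul_tmul]
  rw [this, mulOp_apply]

theorem coaddMag_mul (a b : MagAlg X K) :
    coaddMag X K (a * b) = coaddMag X K a * coaddMag X K b := map_mul (coaddHom X K) a b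

theorem coaddMag_one : coaddMag X K 1 = 1 ⊗ₜ[K] 1 := by
  change coaddHom X K (MonoidAlgebra.single 1 1) = _
  rw [coaddHom]
  simp [MonoidAlgebra.liftMagma]
  rfl

theorem coaddMag_of (x : X) :
    coaddMag X K (MagAlg.of X K x) = MagAlg.of X K x ⊗ₜ[K] 1 + 1 ⊗ₜ[K] MagAlg.of X K x := by
  change coaddHom X K (MonoidAlgebra.single _ 1) = _
  rw [coaddHom]
  simp [MonoidAlgebra.liftMagma]

theorem counitMag_mul (a b : MagAlg X K) :
    counitMag X K (a * b) = counitMag X K a * counitMag X K b := by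
  classical
  have h : ∀ (T : WithOne (FreeMagma X)) (c : K), counitMag X K (MonoidAlgebra.single T c) =
      if T = 1 then c else 0 := by
    intro T c
    simp [counitMag, Finsupp.single_apply]
  induction a using MonoidAlgebra.induction_linear with
  | zero => simp
  | add a a' ha ha' => rw [add_mul, map_add, ha, ha', map_add, add_mul]
  | single S c =>
    induction b using MonoidAlgebra.induction_linear with
    | zero => simp
    | add b b' hb hb' => rw [mul_add, map_add, hb, hb', map_add, mul_add]
    | single T d =>
      rw [MonoidAlgebra.single_mul_single, h, h, h]
      induction S using WithOne.recOneCoe with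
      | one => simp
      | coe s =>
        induction T using WithOne.recOneCoe with
        | one => simp
        | coe t => simp [← WithOne.coe_mul]

theorem isPrimitivelyGenerated_mag :
    IsPrimitivelyGenerated (fun _ : Unit => mulOp (K := K) (MagAlg X K))
      (Set.range (MagAlg.of X K)) 1 (counitMag X K) (coaddMag X K) where
  span_eq_top a := by
    have h1 : ∀ t : FreeMagma X, ∃ n, IsMonomial (fun _ : Unit => mulOp (K := K) (MagAlg X K))
        (Set.range (MagAlg.of X K)) 1 n (MonoidAlgebra.single (t : WithOne (FreeMagma X)) 1) := by
      intro t
      induction t with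
      | ih1 x => exact ⟨1, .gen _ ⟨x, rfl⟩⟩
      | ih2 s t hs ht =>
        obtain ⟨m, hm⟩ := hs
        obtain ⟨n, hn⟩ := ht
        -- The degree is kept as a sum over `Fin 2`, the form produced by `IsMonomial.op`.
        refine ⟨∑ i, ![m, n] i, ?_⟩
        have := IsMonomial.op (f := fun _ : Unit => mulOp (K := K) (MagAlg X K))
          (G := Set.range (MagAlg.of X K)) (e := 1) () ![m, n]
          ![MonoidAlgebra.single (s : WithOne (FreeMagma X)) 1,
            MonoidAlgebra.single (t : WithOne (FreeMagma X)) 1]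
          (by intro i; fin_cases i; exacts [hm, hn])
        rw [mulOp_apply] at this
        simpa [MonoidAlgebra.single_mul_single] using this
    induction a using MonoidAlgebra.induction_linear with
    | zero => exact zero_mem _
    | add a b ha hb => exact add_mem ha hb
    | single T c =>
      have : (MonoidAlgebra.single T c : MagAlg X K) = c • MonoidAlgebra.single T 1 := by simp
      rw [this]
      refine Submodule.smul_mem _ _ (Submodule.subset_span ?_)
      induction T using WithOne.recOneCoe with
      | one => exact ⟨0, .one⟩
      | coe t => exact h1 t
  counit_one := counitMag_one X K
  comul_one := coaddMag_one
  counit_gen := by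
    rintro _ ⟨x, rfl⟩
    simp [counitMag, MagAlg.of]
  comul_gen := by
    rintro _ ⟨x, rfl⟩
    exact coaddMag_of x
  op_one _ := mul_one 1
  counit_op _ a := by rw [mulOp_apply, counitMag_mul, Fin.prod_univ_two]
  comul_op _ a := by rw [mulOp_apply, coaddMag_mul, tensorOp_mulOp]

end Mag

end PlanarPBW

end

theorem mainTheorem2 (K : Type w) [Field K] [CharZero K] (X : Type u) :
    PlanarPBW.IsCofreeOnPrimitives.{max u w, v, w}
      (Finsupp.single none 1) (PlanarPBW.counitInf X K) (PlanarPBW.counitInf_one X K)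
      (PlanarPBW.coaddInf X K) ∧
    PlanarPBW.IsCofreeOnPrimitives.{max u w, v, w}
      (1 : PlanarPBW.MagAlg X K) (PlanarPBW.counitMag X K) (PlanarPBW.counitMag_one X K)
      (PlanarPBW.coaddMag X K) :=
  ⟨PlanarPBW.isPrimitivelyGenerated_magOmega.isCofreeOnPrimitives _ (PlanarPBW.vee X K 2)
      PlanarPBW.vee_two_one_left PlanarPBW.vee_two_one_right PlanarPBW.counitInf_vee
      PlanarPBW.coaddInf_vee,
    PlanarPBW.isPrimitivelyGenerated_mag.isCofreeOnPrimitives _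
      (PlanarPBW.mulOp (PlanarPBW.MagAlg X K)) one_mul mul_one
      (PlanarPBW.isPrimitivelyGenerated_mag.counit_op ())
      (PlanarPBW.isPrimitivelyGenerated_mag.comul_op ())⟩
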